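/- Let $A$ be a commutative associative unital $\mathbb{C}$-algebra, let $\{x^-,h,x^+\}$ be the standard basis of $\mathfrak{sl}_2$ over $\mathbb{C}$ (so $[h,x^\pm]=\pm2x^\pm$, $[x^+,x^-]=h$), let $\mathfrak{sl}_2\otimes A$ be the Lie algebra with bracket $[z\otimes a,z'\otimes b]=[z,z']\otimes ab$, and let $U=\mathbf{U}(\mathfrak{sl}_2\otimes A)$ be its universal enveloping algebra over $\mathbb{C}$. Let $\mathcal F$ be the set of finitely supported functions $\chi:A\to\mathbb{Z}_{\ge0}$ (finite multisets of elements of $A$), with pointwise addition and the pointwise order; for $\chi\in\mathcal F$ write $|\chi|=\sum_{a}\chi(a)$ and $\mathcal F(\chi)=\{\psi\in\mathcal F:\psi\le\chi\}$, and let $\chi_a\in\mathcal F$ be the characteristic function of $\{a\}$. For $\psi\in\mathcal F$ put $$\pi(\psi)=\prod_{a}a^{\psi(a)},\qquad m(\psi)=\frac{|\psi|!}{\prod_a\psi(a)!},\qquad x^\pm(\psi)=\prod_{a}\frac{(x^\pm\otimes a)^{\psi(a)}}{\psi(a)!}\in U .$$ Define $p(\varphi,\chi)\in U$ for $\varphi,\chi\in\mathcal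 F$ recursively by $p(0,0)=1$, $p(\varphi,\chi)=0$ if exactly one of $\varphi,\chi$ is $0$, and for $\varphi,\chi\ne0$ $$p(\varphi,\chi)=-\frac{\delta_{|\varphi|,|\chi|}}{|\varphi|}\sum_{\substack{\psi_1\in\mathcal F(\varphi)\setminus\{0\}\\ \psi_2\in\mathcal F(\chi)\setminus\{0\}}}m(\psi_1)m(\psi_2)\,\bigl(h\otimes\pi(\psi_1)\pi(\psi_2)\bigr)\,p(\varphi-\psi_1,\chi-\psi_2).$$ Define $D^\pm(\psi_1,\psi_2,\psi_3)\in U$ for $\psi_1,\psi_2,\psi_3\in\mathcal F$ recursively by $$D^\pm(\psi_1,\psi_2,0)=\delta_{|\psi_1|+|\psi_2|,0},\qquad D^\pm(\psi_1,\psi_2,\chi_b)=\delta_{|\psi_1|,|\psi_2|}\,m(\psi_1)m(\psi_2)\,\bigl(x^\pm\otimes b\,\pi(\psi_1)\pi(\psi_2)\bigr)\quad(b\in A),$$ and, for $|\psi_3|\geq 2$, $$D^\pm(\psi_1,\psi_2,\psi_3)=\frac1{|\psi_3|}\sum_{\substack{\phi_1\in\mathcal F(\psi_1)\\ \phi_2\in\mathcal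 F(\psi_2)}}\ \sum_{b\in\operatorname{supp}\psi_3}D^\pm(\phi_1,\phi_2,\chi_b)\,D^\pm(\psi_1-\phi_1,\psi_2-\phi_2,\psi_3-\chi_b).$$ Finally put $$\mathbb D(\psi_1,\psi_2,\psi_3)=\sum_{\substack{\phi_1\in\mathcal F(\psi_1)\\ \phi_2\in\mathcal F(\psi_2)}}p(\phi_1,\phi_2)\,D^+(\psi_1-\phi_1,\psi_2-\phi_2,\psi_3).$$ Then for all $\varphi,\chi\in\mathcal F$, $$x^+(\varphi)\,x^-(\chi)=\sum_{\substack{\psi_1,\psi_2,\phi_1,\phi_2\in\mathcal F\\ \psi_1+\psi_2\in\mathcal F(\chi)\\ \phi_1+\phi_2\in\mathcal F(\varphi)}}(-1)^{|\psi_1|+|\psi_2|}\,D^-(\phi_1,\psi_1,\chi-\psi_1-\psi_2)\,\mathbb D(\phi_2,\psi_2,\varphi-\phi_1-\phi_2)\quad\text{in }U.$$ -/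

import Mathlib

open scoped TensorProduct

noncomputable section

namespace MapAlgebra

attribute [local instance 100] LieRing.ofAssociativeRing

/-- The Lie algebra `𝔰𝔩₂` of traceless complex `2 × 2` matrices. -/
abbrev Sl2 : Type := LieAlgebra.SpecialLinear.sl (Fin 2) ℂ

/-- `x⁺ = E₁₂`. -/
def xPlus : Sl2 := LieAlgebra.SpecialLinear.single (0 : Fin 2) 1 (by decide) 1

/-- `x⁻ = E₂₁`. -/
def xMinus : Sl2 := LieAlgebra.SpecialLinear.single (1 : Fin 2) 0 (by decide) 1

/-- `h = E₁₁ - E₂₂`. -/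
def hElt : Sl2 := LieAlgebra.SpecialLinear.singleSubSingle (0 : Fin 2) 1 1

variable {A : Type*} [CommRing A] [Algebra ℂ A]

/-- `U(𝔰𝔩₂ ⊗ A)`. The map algebra is written with its tensor factors in the order used by Mathlib's
Lie algebra structure on a base change, `A ⊗ 𝔰𝔩₂` with `⁅a ⊗ z, b ⊗ w⁆ = ab ⊗ ⁅z, w⁆`, regarded as
a Lie algebra over `ℂ`. -/
abbrev U (A : Type*) [CommRing A] [Algebra ℂ A] : Type _ :=
  UniversalEnvelopingAlgebra ℂ (A ⊗[ℂ] Sl2)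

/-- The element `z ⊗ a` of `U(𝔰𝔩₂ ⊗ A)`. -/
def elt (z : Sl2) (a : A) : U A := UniversalEnvelopingAlgebra.ι ℂ (a ⊗ₜ[ℂ] z)

theorem elt_commute (z : Sl2) (a b : A) : Commute (elt z a) (elt z b) := by
  have h : UniversalEnvelopingAlgebra.ι ℂ ⁅a ⊗ₜ[ℂ] z, b ⊗ₜ[ℂ] z⁆ = (0 : U A) := by
    rw [LieAlgebra.ExtendScalars.bracket_tmul, lie_self, TensorProduct.tmul_zero, map_zero]
  rw [LieHom.map_lie, LieRing.of_associative_ring_bracket] at h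
  exact sub_eq_zero.mp h

/-- The divided power `u^(r) = u ^ r / r!`. -/
def divPow (u : U A) (r : ℕ) : U A := ((r.factorial : ℂ)⁻¹) • u ^ r

/-- `π(ψ) = ∏ a ^ ψ(a)`. -/
def piProd (ψ : A →₀ ℕ) : A := ψ.prod fun a n => a ^ n

/-- `m(ψ) = |ψ|! / ∏ ψ(a)!`, where `|ψ| = Finsupp.degree ψ`. -/
def multi (ψ : A →₀ ℕ) : ℂ :=
  (ψ.degree.factorial : ℂ) / ψ.prod fun _ n => (n.factorial : ℂ)

/-- `∏ (z ⊗ a)^(ψ(a))`, a product of commuting elements. -/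
def xProd (z : Sl2) (ψ : A →₀ ℕ) : U A :=
  ψ.support.noncommProd (fun a => divPow (elt z a) (ψ a)) fun a _ b _ _ =>
    (((elt_commute z a b).pow_pow (ψ a) (ψ b)).smul_left _).smul_right _

theorem degree_sub_lt {S : Type*} {ψ φ : S →₀ ℕ} (h0 : ψ ≠ 0) (h : ψ ≤ φ) :
    (φ - ψ).degree < φ.degree := by
  have h1 : (φ - ψ).degree + ψ.degree = φ.degree := by
    rw [← map_add, tsub_add_cancel_of_le h]
  have h2 : ψ.degree ≠ 0 := fun h => h0 ((Finsupp.degree_eq_zero_iff ψ).mp h)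
  omega

theorem single_le {S : Type*} {ψ : S →₀ ℕ} {b : S} (hb : b ∈ ψ.support) : Finsupp.single b 1 ≤ ψ := by
  rw [Finsupp.single_le_iff]
  exact Nat.one_le_iff_ne_zero.mpr (Finsupp.mem_support_iff.mp hb)

open Classical in
/-- The elements `p(φ, χ)`: `p(0, 0) = 1`, and otherwise
`p(φ, χ) = -(δ_{|φ|,|χ|} / |φ|) ∑ m(ψ₁) m(ψ₂) (h ⊗ π(ψ₁) π(ψ₂)) p(φ - ψ₁, χ - ψ₂)`,
over the nonzero `ψ₁ ≤ φ` and `ψ₂ ≤ χ`. If exactly one of `φ, χ` is zero, the sum is empty and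
`p(φ, χ) = 0`. -/
def p (φ χ : A →₀ ℕ) : U A :=
  if φ = 0 ∧ χ = 0 then 1
  else (-((if φ.degree = χ.degree then 1 else 0) / (φ.degree : ℂ))) •
    ∑ ψ₁ ∈ ((Finset.Iic φ).erase 0).attach, ∑ ψ₂ ∈ (Finset.Iic χ).erase 0,
      (multi ψ₁.1 * multi ψ₂) •
        (elt hElt (piProd ψ₁.1 * piProd ψ₂) * p (φ - ψ₁.1) (χ - ψ₂))
termination_by φ.degree
decreasing_by
  exact degree_sub_lt (Finset.ne_of_mem_erase ψ₁.2)
    (Finset.mem_Iic.mp (Finset.mem_of_mem_erase ψ₁.2))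

/-- `δ_{|ψ₁|,|ψ₂|} m(ψ₁) m(ψ₂) (z ⊗ b π(ψ₁) π(ψ₂))`: the value at `(ψ₁, ψ₂, χ_b)` of `D`. -/
def DOne (z : Sl2) (ψ₁ ψ₂ : A →₀ ℕ) (b : A) : U A :=
  if ψ₁.degree = ψ₂.degree then
    (multi ψ₁ * multi ψ₂) • elt z (b * piProd ψ₁ * piProd ψ₂)
  else 0

open Classical in
/-- The elements `D(ψ₁, ψ₂, ψ₃)` attached to `z` (`z = x⁺` gives `D⁺`, `z = x⁻` gives `D⁻`). On
`ψ₃ = χ_b` the recursion returns the prescribed initial value, see `D_single`. -/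
def D (z : Sl2) (ψ₁ ψ₂ ψ₃ : A →₀ ℕ) : U A :=
  if ψ₃ = 0 then (if ψ₁.degree + ψ₂.degree = 0 then 1 else 0)
  else ((ψ₃.degree : ℂ)⁻¹) •
    ∑ φ₁ ∈ Finset.Iic ψ₁, ∑ φ₂ ∈ Finset.Iic ψ₂, ∑ b ∈ ψ₃.support.attach,
      DOne z φ₁ φ₂ b.1 * D z (ψ₁ - φ₁) (ψ₂ - φ₂) (ψ₃ - Finsupp.single b.1 1)
termination_by ψ₃.degree
decreasing_by
  exact degree_sub_lt (by simp) (single_le b.2)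

/-- `D⁺`. -/
abbrev DPlus (ψ₁ ψ₂ ψ₃ : A →₀ ℕ) : U A := D xPlus ψ₁ ψ₂ ψ₃

/-- `D⁻`. -/
abbrev DMinus (ψ₁ ψ₂ ψ₃ : A →₀ ℕ) : U A := D xMinus ψ₁ ψ₂ ψ₃

open Classical in
/-- `𝔻(ψ₁, ψ₂, ψ₃) = ∑ p(φ₁, φ₂) D⁺(ψ₁ - φ₁, ψ₂ - φ₂, ψ₃)` over `φ₁ ≤ ψ₁` and `φ₂ ≤ ψ₂`. -/
def DD (ψ₁ ψ₂ ψ₃ : A →₀ ℕ) : U A :=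
  ∑ φ₁ ∈ Finset.Iic ψ₁, ∑ φ₂ ∈ Finset.Iic ψ₂, p φ₁ φ₂ * DPlus (ψ₁ - φ₁) (ψ₂ - φ₂) ψ₃

/-! The defining relations, in the form in which the recursions are usually written. -/

theorem p_zero_zero : p (0 : A →₀ ℕ) 0 = 1 := by
  rw [p]; simp

open Classical in
theorem p_rec {φ χ : A →₀ ℕ} (hφ : φ ≠ 0) :
    p φ χ = (-((if φ.degree = χ.degree then 1 else 0) / (φ.degree : ℂ))) •
      ∑ ψ₁ ∈ (Finset.Iic φ).erase 0, ∑ ψ₂ ∈ (Finset.Iic χ).erase 0,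
        (multi ψ₁ * multi ψ₂) •
          (elt hElt (piProd ψ₁ * piProd ψ₂) * p (φ - ψ₁) (χ - ψ₂)) := by
  rw [p, if_neg fun h => hφ h.1]
  congr 1
  exact Finset.sum_attach _ fun ψ₁ => ∑ ψ₂ ∈ (Finset.Iic χ).erase 0,
        (multi ψ₁ * multi ψ₂) •
          (elt hElt (piProd ψ₁ * piProd ψ₂) * p (φ - ψ₁) (χ - ψ₂))

theorem p_eq_zero {φ χ : A →₀ ℕ} (h : φ.degree ≠ χ.degree) : p φ χ = 0 := by
  rw [p, if_neg (by rintro ⟨rfl, rfl⟩; exact h rfl), if_neg h]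
  simp

theorem D_zero (z : Sl2) (ψ₁ ψ₂ : A →₀ ℕ) :
    D z ψ₁ ψ₂ 0 = if ψ₁.degree + ψ₂.degree = 0 then 1 else 0 := by
  rw [D, if_pos rfl]

open Classical in
theorem D_rec_one (z : Sl2) (ψ₁ ψ₂ : A →₀ ℕ) {ψ₃ : A →₀ ℕ} (h : ψ₃ ≠ 0) :
    D z ψ₁ ψ₂ ψ₃ = ((ψ₃.degree : ℂ)⁻¹) •
      ∑ φ₁ ∈ Finset.Iic ψ₁, ∑ φ₂ ∈ Finset.Iic ψ₂, ∑ b ∈ ψ₃.support,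
        DOne z φ₁ φ₂ b * D z (ψ₁ - φ₁) (ψ₂ - φ₂) (ψ₃ - Finsupp.single b 1) := by
  rw [D, if_neg h]
  congr 1
  refine Finset.sum_congr rfl fun φ₁ _ => Finset.sum_congr rfl fun φ₂ _ => ?_
  exact Finset.sum_attach _ fun b =>
    DOne z φ₁ φ₂ b * D z (ψ₁ - φ₁) (ψ₂ - φ₂) (ψ₃ - Finsupp.single b 1)

theorem D_single (z : Sl2) (ψ₁ ψ₂ : A →₀ ℕ) (b : A) :
    D z ψ₁ ψ₂ (Finsupp.single b 1) = DOne z ψ₁ ψ₂ b := by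
  classical
  rw [D_rec_one z ψ₁ ψ₂ (by simp), Finsupp.support_single _ one_ne_zero]
  simp only [Finset.sum_singleton, tsub_self, D_zero]
  rw [Finset.sum_eq_single ψ₁, Finset.sum_eq_single ψ₂]
  · simp
  · intro φ hφ hne
    have h1 : ψ₂ - φ ≠ 0 := fun h => hne (le_antisymm (Finset.mem_Iic.mp hφ)
      (tsub_eq_zero_iff_le.mp h))
    have h2 : (ψ₂ - φ).degree ≠ 0 := fun h => h1 ((Finsupp.degree_eq_zero_iff _).mp h)
    rw [if_neg (by omega), mul_zero]
  · simp
  · intro φ hφ hne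
    have h1 : ψ₁ - φ ≠ 0 := fun h => hne (le_antisymm (Finset.mem_Iic.mp hφ)
      (tsub_eq_zero_iff_le.mp h))
    have h2 : (ψ₁ - φ).degree ≠ 0 := fun h => h1 ((Finsupp.degree_eq_zero_iff _).mp h)
    refine Finset.sum_eq_zero fun φ₂ _ => ?_
    rw [if_neg (by omega), mul_zero]
  · simp

open Classical in
theorem D_rec (z : Sl2) (ψ₁ ψ₂ : A →₀ ℕ) {ψ₃ : A →₀ ℕ} (h : ψ₃ ≠ 0) :
    D z ψ₁ ψ₂ ψ₃ = ((ψ₃.degree : ℂ)⁻¹) •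
      ∑ φ₁ ∈ Finset.Iic ψ₁, ∑ φ₂ ∈ Finset.Iic ψ₂, ∑ b ∈ ψ₃.support,
        D z φ₁ φ₂ (Finsupp.single b 1) *
          D z (ψ₁ - φ₁) (ψ₂ - φ₂) (ψ₃ - Finsupp.single b 1) := by
  simp only [D_single]
  exact D_rec_one z ψ₁ ψ₂ h

end MapAlgebra

end

open MapAlgebra

/-!
The identity is the coefficientwise form of a Gauss decomposition in the loop group of `SL₂`. Let
`u = ∑ s_a a` and `v = ∑ t_b b` be generic elements of `A`, with one variable `s_a` and one variable
`t_a` for every `a` in `A`, and put `g = 1 / (1 + u v)`. In power series over `U(𝔰𝔩₂ ⊗ A)`,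

`exp (x⁺ ⊗ u) exp (x⁻ ⊗ v) = exp (x⁻ ⊗ v g) exp (h ⊗ log (1 + u v)) exp (x⁺ ⊗ u g)`,

as for the product of a unipotent upper and a unipotent lower triangular `2 × 2` matrix. The
coefficients at `s^φ` and `t^χ` of the factors on the left are `x⁺(φ)` and `x⁻(χ)`. Those of the
factors on the right are, up to the sign `(-1)^|t-degree|`, sums of `D⁻`, the elements `p`, and sums
of `D⁺`: the multinomial coefficients `m(ψ)` are those of a geometric series in `u` or `v`, and the
recursions are the differential equations that Euler derivations impose on exponentials.

Exponentials of non-commuting series are never formed. A solution of `E Z = c Z`, for the Euler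
derivation `E` of a weight on the variables, is determined by its part of weight zero
(`eq_zero_of_euler_eq_mul`), and every identity is proved by showing that both sides solve such an
equation.

* In the series of `D`, a third set of variables `y` is present, and the recursion gives the equation
  of `exp (z ⊗ y g)` for the derivation in `y`. The equations for all other Euler derivations follow
  (`euler_serD`). They survive the specialization of `y` to `t` or to `s` (`push`), which yields the
  series `serM` of `D⁻` and `serN` of `D⁺`.
* The `s`- and the `t`-derivative of the series `serP` of `p` agree, as `p` is supported on pairs of
  multisets of equal size.
* The `s`-derivative kills `v`. Uniqueness of solutions for it therefore gives the commutation rules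
  of `serP` and `serN` with `x⁻ ⊗ v` (`serP_mul_lift_serV`, `serN_mul_lift_serV`).
* By these rules both sides of the decomposition solve the equation `E Z = Z (x⁻ ⊗ v)` for the
  `t`-derivative, and they agree at `t = 0` (`serXPlus_mul_serXMinus`).
-/

open scoped TensorProduct

noncomputable section

namespace MapAlgebra

open MvPowerSeries Finset

/-! ### Power series with non-commutative coefficients -/

section PowerSeries

variable {σ τ α β B C : Type*} [Ring B] [CommRing C]

theorem sum_antidiagonal_comm [DecidableEq σ] {N : Type*} [AddCommMonoid N] (n : σ →₀ ℕ)
    (f : (σ →₀ ℕ) → (σ →₀ ℕ) → N) :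
    ∑ x ∈ antidiagonal n, f x.1 x.2 = ∑ x ∈ antidiagonal n, f x.2 x.1 := by
  conv_lhs => rw [← HasAntidiagonal.map_swap_antidiagonal, sum_map]
  rfl

theorem sumElim_inj {φ φ' : α →₀ ℕ} {χ χ' : β →₀ ℕ} :
    Finsupp.sumElim φ χ = Finsupp.sumElim φ' χ' ↔ φ = φ' ∧ χ = χ' :=
  (Finsupp.sumFinsuppEquivProdFinsupp.symm.injective.eq_iff (a := (φ, χ)) (b := (φ', χ'))).trans
    Prod.mk_inj

theorem exists_sumElim (n : α ⊕ β →₀ ℕ) : ∃ φ χ, n = Finsupp.sumElim φ χ :=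
  ⟨_, _, (Finsupp.comapDomain_sumElim_comapDomain n).symm⟩

theorem ext_sumElim {F G : MvPowerSeries (α ⊕ β) B}
    (h : ∀ a b, coeff (Finsupp.sumElim a b) F = coeff (Finsupp.sumElim a b) G) : F = G := by
  ext n
  rw [← Finsupp.comapDomain_sumElim_comapDomain n]
  exact h _ _

theorem sum_antidiagonal_sumElim [DecidableEq α] [DecidableEq β] [DecidableEq (α ⊕ β)]
    {N : Type*} [AddCommMonoid N]
    (a : α →₀ ℕ) (b : β →₀ ℕ) (f : (α ⊕ β →₀ ℕ) → (α ⊕ β →₀ ℕ) → N) :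
    ∑ x ∈ antidiagonal (Finsupp.sumElim a b), f x.1 x.2 =
      ∑ p ∈ antidiagonal a, ∑ q ∈ antidiagonal b,
        f (Finsupp.sumElim p.1 q.1) (Finsupp.sumElim p.2 q.2) := by
  rw [← sum_product']
  symm
  refine sum_nbij (fun x => (Finsupp.sumElim x.1.1 x.2.1, Finsupp.sumElim x.1.2 x.2.2))
    ?_ ?_ ?_ (fun _ _ => rfl)
  · rintro ⟨⟨a1, a2⟩, b1, b2⟩ h
    simp only [mem_product, HasAntidiagonal.mem_antidiagonal] at h ⊢
    rw [← Finsupp.sumElim_add, h.1, h.2]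
  · rintro ⟨⟨a1, a2⟩, b1, b2⟩ - ⟨⟨a1', a2'⟩, b1', b2'⟩ - h
    simp_all [sumElim_inj]
  · rintro ⟨x, y⟩ h
    obtain ⟨a1, b1, rfl⟩ := exists_sumElim x
    obtain ⟨a2, b2, rfl⟩ := exists_sumElim y
    rw [mem_coe, HasAntidiagonal.mem_antidiagonal, ← Finsupp.sumElim_add, sumElim_inj] at h
    exact ⟨((a1, a2), (b1, b2)), by simpa using h, rfl⟩

theorem coeff_sumElim_mul [DecidableEq α] [DecidableEq β] (F G : MvPowerSeries (α ⊕ β) B)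
    (a : α →₀ ℕ) (b : β →₀ ℕ) :
    coeff (Finsupp.sumElim a b) (F * G) = ∑ p ∈ antidiagonal a, ∑ q ∈ antidiagonal b,
      coeff (Finsupp.sumElim p.1 q.1) F * coeff (Finsupp.sumElim p.2 q.2) G := by
  rw [coeff_mul]
  exact sum_antidiagonal_sumElim a b fun x y => coeff x F * coeff y G

/-- The Euler derivation that multiplies the coefficient at `n` by the weight `∑ n i * ω i`. -/
def euler (ω : σ → ℕ) : MvPowerSeries σ B →+ MvPowerSeries σ B where
  toFun F := fun n => Finsupp.weight ω n • coeff n F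
  map_zero' := by
    ext n
    exact smul_zero _
  map_add' F G := by
    ext n
    exact smul_add _ _ _

theorem coeff_euler (ω : σ → ℕ) (F : MvPowerSeries σ B) (n : σ →₀ ℕ) :
    coeff n (euler ω F) = Finsupp.weight ω n • coeff n F := rfl

theorem euler_mul (ω : σ → ℕ) (F G : MvPowerSeries σ B) :
    euler ω (F * G) = euler ω F * G + F * euler ω G := by
  classical
  ext n
  simp only [coeff_euler, map_add, coeff_mul, smul_sum, ← sum_add_distrib]
  refine sum_congr rfl fun x hx => ?_
  rw [← HasAntidiagonal.mem_antidiagonal.mp hx, map_add, add_smul, smul_mul_assoc, mul_smul_comm]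

theorem euler_one (ω : σ → ℕ) : euler ω (1 : MvPowerSeries σ B) = 0 := by
  simpa using euler_mul ω (1 : MvPowerSeries σ B) 1

theorem euler_comm (ω ω' : σ → ℕ) (F : MvPowerSeries σ B) :
    euler ω (euler ω' F) = euler ω' (euler ω F) := by
  ext n
  simp only [coeff_euler, smul_smul, mul_comm]

/-- A solution of the linear equation `E Z = c Z`, for an Euler derivation `E` and a series `c`
without terms of weight zero, vanishes once its part of weight zero does. -/
theorem eq_zero_of_euler_eq_mul [IsAddTorsionFree B] (ω : σ → ℕ) {Z c : MvPowerSeries σ B}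
    (hc : ∀ n, Finsupp.weight ω n = 0 → coeff n c = 0)
    (hZ : ∀ n, Finsupp.weight ω n = 0 → coeff n Z = 0) (h : euler ω Z = c * Z) : Z = 0 := by
  classical
  suffices H : ∀ k n, Finsupp.weight ω n = k → coeff n Z = 0 from ext fun n => H _ n rfl
  intro k
  induction k using Nat.strong_induction_on with
  | _ k ih =>
    intro n hn
    rcases Nat.eq_zero_or_pos k with rfl | hk
    · exact hZ n hn
    have h1 := congrArg (coeff n) h
    rw [coeff_euler, coeff_mul, hn, sum_eq_zero] at h1
    · exact (smul_eq_zero.mp h1).resolve_left hk.ne'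
    · intro x hx
      have hs : Finsupp.weight ω x.1 + Finsupp.weight ω x.2 = k := by
        rw [← map_add, HasAntidiagonal.mem_antidiagonal.mp hx, hn]
      rcases Nat.eq_zero_or_pos (Finsupp.weight ω x.1) with h0 | h0
      · rw [hc _ h0, zero_mul]
      · rw [ih _ (by omega) x.2 rfl, mul_zero]

theorem eq_zero_of_euler_eq_mul_right [IsAddTorsionFree B] (ω : σ → ℕ) {Z c : MvPowerSeries σ B}
    (hc : ∀ n, Finsupp.weight ω n = 0 → coeff n c = 0)
    (hZ : ∀ n, Finsupp.weight ω n = 0 → coeff n Z = 0) (h : euler ω Z = Z * c) : Z = 0 := by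
  classical
  suffices H : ∀ k n, Finsupp.weight ω n = k → coeff n Z = 0 from ext fun n => H _ n rfl
  intro k
  induction k using Nat.strong_induction_on with
  | _ k ih =>
    intro n hn
    rcases Nat.eq_zero_or_pos k with rfl | hk
    · exact hZ n hn
    have h1 := congrArg (coeff n) h
    rw [coeff_euler, coeff_mul, hn, sum_eq_zero] at h1
    · exact (smul_eq_zero.mp h1).resolve_left hk.ne'
    · intro x hx
      have hs : Finsupp.weight ω x.1 + Finsupp.weight ω x.2 = k := by
        rw [← map_add, HasAntidiagonal.mem_antidiagonal.mp hx, hn]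
      rcases Nat.eq_zero_or_pos (Finsupp.weight ω x.2) with h0 | h0
      · rw [hc _ h0, mul_zero]
      · rw [ih _ (by omega) x.1 rfl, zero_mul]

theorem coeff_mul_eq_zero_of_weight (ω : σ → ℕ) {F G : MvPowerSeries σ B}
    (hF : ∀ n, Finsupp.weight ω n = 0 → coeff n F = 0) (n : σ →₀ ℕ)
    (hn : Finsupp.weight ω n = 0) : coeff n (F * G) = 0 := by
  classical
  rw [coeff_mul]
  refine sum_eq_zero fun x hx => ?_
  have hs : Finsupp.weight ω x.1 + Finsupp.weight ω x.2 = 0 := by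
    rw [← map_add, HasAntidiagonal.mem_antidiagonal.mp hx, hn]
  rw [hF _ (by omega), zero_mul]

theorem commute_of_coeff {F G : MvPowerSeries σ B}
    (h : ∀ m n, Commute (coeff m F) (coeff n G)) : Commute F G := by
  classical
  ext n
  rw [coeff_mul, coeff_mul, sum_antidiagonal_comm n fun a b => coeff a F * coeff b G]
  exact sum_congr rfl fun x _ => h _ _

/-- An additive map `C → B`, applied to all coefficients of a power series. -/
def lift (z : C →+ B) : MvPowerSeries σ C →+ MvPowerSeries σ B where
  toFun f := fun n => z (coeff n f)
  map_zero' := by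
    ext n
    exact map_zero z
  map_add' f g := by
    ext n
    exact map_add z _ _

theorem coeff_lift (z : C →+ B) (f : MvPowerSeries σ C) (n : σ →₀ ℕ) :
    coeff n (lift z f) = z (coeff n f) := rfl

theorem euler_lift (ω : σ → ℕ) (z : C →+ B) (f : MvPowerSeries σ C) :
    euler ω (lift z f) = lift z (euler ω f) := by
  ext n
  simp only [coeff_euler, coeff_lift, map_nsmul]

/-- Commutation relations between the values of additive maps persist for power series. -/
theorem lift_mul_lift {x y z : C →+ B} (h : ∀ a b, x a * y b = y b * x a + z (a * b))
    (f g : MvPowerSeries σ C) : lift x f * lift y g = lift y g * lift x f + lift z (f * g) := by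
  classical
  ext n
  rw [map_add, coeff_lift, coeff_mul, coeff_mul, coeff_mul, map_sum,
    sum_antidiagonal_comm n fun a b => coeff a (lift y g) * coeff b (lift x f), ← sum_add_distrib]
  exact sum_congr rfl fun p _ => h _ _

end PowerSeries

/-! ### Merging variables -/

theorem weight_mapDomain {σ τ : Type*} (f : σ → τ) (ω : τ → ℕ) (n : σ →₀ ℕ) :
    Finsupp.weight ω (n.mapDomain f) = Finsupp.weight (ω ∘ f) n := by
  rw [Finsupp.weight_apply, Finsupp.weight_apply, Finsupp.sum_mapDomain_index]
  · rfl
  · simp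
  · simp [add_mul]

section Push

variable {σ τ : Type*} {B C : Type*} [Ring B] [CommRing C]
variable (f : σ → τ) [Filter.TendstoCofinite f]

/-- The exponents in the variables `σ` that become `x` under `f`. -/
def fiber (x : τ →₀ ℕ) : Finset (σ →₀ ℕ) :=
  (Filter.TendstoCofinite.finite_preimage_singleton (Finsupp.mapDomain f) x).toFinset

theorem mem_fiber {x : τ →₀ ℕ} {n : σ →₀ ℕ} : n ∈ fiber f x ↔ n.mapDomain f = x := by
  simp [fiber]

/-- Rename the variables of a power series along a map with finite fibers. Mathlib's
`MvPowerSeries.rename` is restricted to commutative coefficients. -/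
def push : MvPowerSeries σ B →+ MvPowerSeries τ B where
  toFun F := fun x => ∑ n ∈ fiber f x, coeff n F
  map_zero' := by
    ext n
    exact sum_const_zero
  map_add' F G := by
    ext n
    exact sum_add_distrib

theorem coeff_push (F : MvPowerSeries σ B) (x : τ →₀ ℕ) :
    coeff x (push f F) = ∑ n ∈ fiber f x, coeff n F := rfl

theorem push_mul (F G : MvPowerSeries σ B) : push f (F * G) = push f F * push f G := by
  classical
  ext x
  simp only [coeff_push, coeff_mul, sum_mul_sum, ← sum_product']
  rw [sum_sigma', sum_sigma']
  refine sum_nbij' (fun y => ⟨(y.2.1.mapDomain f, y.2.2.mapDomain f), y.2⟩)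
    (fun y => ⟨y.2.1 + y.2.2, y.2⟩) ?_ ?_ ?_ ?_ ?_
  · rintro ⟨n, a, b⟩ h
    simp only [mem_sigma, mem_fiber, HasAntidiagonal.mem_antidiagonal, mem_product, and_self, and_true] at h ⊢
    rw [← Finsupp.mapDomain_add, h.2, h.1]
  · rintro ⟨⟨c, d⟩, a, b⟩ h
    simp only [mem_sigma, mem_fiber, HasAntidiagonal.mem_antidiagonal, mem_product, and_true] at h ⊢
    rw [Finsupp.mapDomain_add, h.2.1, h.2.2, h.1]
  · rintro ⟨n, a, b⟩ h
    simp only [mem_sigma, mem_fiber, HasAntidiagonal.mem_antidiagonal] at h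
    obtain ⟨-, rfl⟩ := h
    rfl
  · rintro ⟨⟨c, d⟩, a, b⟩ h
    simp only [mem_sigma, mem_fiber, HasAntidiagonal.mem_antidiagonal, mem_product] at h
    obtain ⟨-, rfl, rfl⟩ := h
    rfl
  · rintro ⟨n, a, b⟩ h
    rfl

theorem push_lift (z : C →+ B) (g : MvPowerSeries σ C) :
    push f (lift z g) = lift z (push f g) := by
  ext n
  simp only [coeff_push, coeff_lift, map_sum]

theorem euler_push (ω : τ → ℕ) (F : MvPowerSeries σ B) :
    euler ω (push f F) = push f (euler (ω ∘ f) F) := by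
  ext n
  simp only [coeff_push, coeff_euler, smul_sum]
  refine sum_congr rfl fun x hx => ?_
  rw [← weight_mapDomain, (mem_fiber f).mp hx]

end Push

open Classical

/-! ### Sums over multisets -/

section Sums

variable {S N : Type*} [AddCommMonoid N]

theorem sum_Iic_eq_sum_antidiagonal (φ : S →₀ ℕ) (f : (S →₀ ℕ) → (S →₀ ℕ) → N) :
    ∑ ψ ∈ Iic φ, f ψ (φ - ψ) = ∑ x ∈ antidiagonal φ, f x.1 x.2 := by
  refine sum_nbij' (fun ψ => (ψ, φ - ψ)) (fun x => x.1) ?_ ?_ ?_ ?_ ?_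
  · intro ψ h
    simpa using add_tsub_cancel_of_le (mem_Iic.mp h)
  · rintro ⟨a, b⟩ h
    rw [HasAntidiagonal.mem_antidiagonal] at h
    simp [← h]
  · intro ψ _
    rfl
  · rintro ⟨a, b⟩ h
    rw [HasAntidiagonal.mem_antidiagonal] at h
    simp [← h]
  · intro ψ _
    rfl

theorem sum_Iic_Iic_eq_sum_antidiagonal {T : Type*} (φ : S →₀ ℕ) (ψ : T →₀ ℕ)
    (f : (S →₀ ℕ) → (S →₀ ℕ) → (T →₀ ℕ) → (T →₀ ℕ) → N) :
    ∑ φ₁ ∈ Iic φ, ∑ ψ₁ ∈ Iic ψ, f φ₁ (φ - φ₁) ψ₁ (ψ - ψ₁) =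
      ∑ x ∈ antidiagonal φ, ∑ y ∈ antidiagonal ψ, f x.1 x.2 y.1 y.2 := by
  rw [← sum_Iic_eq_sum_antidiagonal φ fun a b => ∑ y ∈ antidiagonal ψ, f a b y.1 y.2]
  exact sum_congr rfl fun φ₁ _ => sum_Iic_eq_sum_antidiagonal ψ _

theorem sum_filter_add_le_left (χ : S →₀ ℕ) (f : (S →₀ ℕ) → (S →₀ ℕ) → (S →₀ ℕ) → N) :
    ∑ ψ ∈ Iic χ ×ˢ Iic χ with ψ.1 + ψ.2 ≤ χ, f ψ.1 ψ.2 (χ - ψ.1 - ψ.2) =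
      ∑ x ∈ antidiagonal χ, ∑ y ∈ antidiagonal x.2, f x.1 y.1 y.2 := by
  rw [sum_sigma']
  refine sum_nbij' (fun ψ => ⟨(ψ.1, χ - ψ.1), (ψ.2, χ - ψ.1 - ψ.2)⟩) (fun x => (x.1.1, x.2.1))
    ?_ ?_ ?_ ?_ ?_
  · rintro ⟨a, b⟩ h
    simp only [mem_filter, mem_product, mem_Iic, mem_sigma, HasAntidiagonal.mem_antidiagonal] at h ⊢
    exact ⟨add_tsub_cancel_of_le h.1.1, add_tsub_cancel_of_le (le_tsub_of_add_le_left h.2)⟩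
  · rintro ⟨⟨a, b⟩, c, d⟩ h
    simp only [mem_filter, mem_product, mem_Iic, mem_sigma, HasAntidiagonal.mem_antidiagonal] at h ⊢
    obtain ⟨rfl, rfl⟩ := h
    refine ⟨⟨le_self_add, ?_⟩, ?_⟩
    · exact le_add_left le_self_add
    · rw [← add_assoc]
      exact le_self_add
  · rintro ⟨a, b⟩ _
    rfl
  · rintro ⟨⟨a, b⟩, c, d⟩ h
    simp only [mem_sigma, HasAntidiagonal.mem_antidiagonal] at h
    obtain ⟨rfl, rfl⟩ := h
    simp
  · rintro ⟨a, b⟩ _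
    rfl

theorem sum_antidiagonal_assoc (χ : S →₀ ℕ) (f : (S →₀ ℕ) → (S →₀ ℕ) → (S →₀ ℕ) → N) :
    ∑ x ∈ antidiagonal χ, ∑ y ∈ antidiagonal x.2, f x.1 y.1 y.2 =
      ∑ x ∈ antidiagonal χ, ∑ y ∈ antidiagonal x.1, f y.1 y.2 x.2 := by
  rw [sum_sigma', sum_sigma']
  refine sum_nbij' (fun x => ⟨(x.1.1 + x.2.1, x.2.2), (x.1.1, x.2.1)⟩)
    (fun x => ⟨(x.2.1, x.2.2 + x.1.2), (x.2.2, x.1.2)⟩) ?_ ?_ ?_ ?_ ?_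
  all_goals
    rintro ⟨⟨a, b⟩, c, d⟩ h
    simp only [mem_sigma, HasAntidiagonal.mem_antidiagonal] at h ⊢
    try obtain ⟨rfl, rfl⟩ := h
    try simp [add_assoc]

theorem degree_sub_single_add_one {φ : S →₀ ℕ} {b : S} (hb : b ∈ φ.support) :
    (φ - Finsupp.single b 1).degree + 1 = φ.degree := by
  conv_rhs => rw [← tsub_add_cancel_of_le (single_le hb)]
  simp

theorem exists_eq_single_of_degree_eq_one {φ : S →₀ ℕ} (h : φ.degree = 1) :
    ∃ b, φ = Finsupp.single b 1 := by
  have h0 : φ ≠ 0 := by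
    rintro rfl
    simp at h
  obtain ⟨b, hb⟩ := Finsupp.support_nonempty_iff.mpr h0
  refine ⟨b, ?_⟩
  have h1 := degree_sub_single_add_one hb
  have h2 : φ - Finsupp.single b 1 = 0 := (Finsupp.degree_eq_zero_iff _).mp (by omega)
  exact le_antisymm (tsub_eq_zero_iff_le.mp h2) (single_le hb)

theorem sum_apply_eq_degree (φ : S →₀ ℕ) : ∑ b ∈ φ.support, φ b = φ.degree := rfl

theorem erase_sub_single (φ : S →₀ ℕ) (b : S) :
    (φ - Finsupp.single b 1).erase b = φ.erase b := by
  ext a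
  by_cases h : a = b
  · simp [h]
  · simp [h]

theorem prod_eq_mul_prod_erase {M : Type*} [CommMonoid M] (φ : S →₀ ℕ) (b : S) (g : S → ℕ → M)
    (hg : g b 0 = 1) : φ.prod g = g b (φ b) * (φ.erase b).prod g := by
  by_cases h : b ∈ φ.support
  · exact (Finsupp.mul_prod_erase φ b g h).symm
  · have h0 : φ b = 0 := Finsupp.notMem_support_iff.mp h
    rw [h0, hg, one_mul, Finsupp.erase_of_notMem_support h]

end Sums

section LinPart

variable {A : Type*} [CommRing A]

/-- The part of degree one of a multiset: `b` for `χ = χ_b`, and zero if `|χ| ≠ 1`. It is the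
coefficient at `χ` of the generic linear form `∑ t_b b`. -/
def linPart (χ : A →₀ ℕ) : A := if χ.degree = 1 then χ.sum fun a k => k • a else 0

theorem linPart_single (b : A) : linPart (Finsupp.single b 1) = b := by
  simp [linPart]

theorem linPart_of_degree_ne_one {χ : A →₀ ℕ} (h : χ.degree ≠ 1) : linPart χ = 0 := if_neg h

theorem linPart_zero : linPart (0 : A →₀ ℕ) = 0 := by
  simp [linPart]

theorem sum_antidiagonal_linPart {N : Type*} [AddCommMonoid N] (χ : A →₀ ℕ)
    (G : A → (A →₀ ℕ) → N) (hG : ∀ ψ, G 0 ψ = 0) :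
    ∑ r ∈ antidiagonal χ, G (linPart r.1) r.2 =
      ∑ b ∈ χ.support, G b (χ - Finsupp.single b 1) := by
  symm
  refine sum_of_injOn (fun b => (Finsupp.single b 1, χ - Finsupp.single b 1)) ?_ ?_ ?_ ?_
  · intro a _ b _ h
    exact Finsupp.single_left_injective one_ne_zero (Prod.ext_iff.mp h).1
  · intro b hb
    simpa using add_tsub_cancel_of_le (single_le (mem_coe.mp hb))
  · rintro ⟨x, y⟩ h hn
    by_cases hd : x.degree = 1
    · obtain ⟨b, rfl⟩ := exists_eq_single_of_degree_eq_one hd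
      rw [HasAntidiagonal.mem_antidiagonal] at h
      refine absurd ⟨b, ?_, ?_⟩ hn
      · simp [← h]
      · simp [← h]
    · rw [linPart_of_degree_ne_one hd, hG]
  · intro b _
    rw [linPart_single]

end LinPart

variable {A : Type*} [CommRing A] [Algebra ℂ A]

/-! ### The enveloping algebra -/

instance : IsAddTorsionFree (U A) where
  nsmul_right_injective n hn x y h := by
    have h' : (n : ℂ) • x = (n : ℂ) • y := by simpa only [Nat.cast_smul_eq_nsmul] using h
    exact smul_right_injective _ (Nat.cast_ne_zero.mpr hn) h'

/-- The additive map `a ↦ z ⊗ a`. -/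
def eltHom (z : Sl2) : A →+ U A where
  toFun := elt z
  map_zero' := by rw [elt, TensorProduct.zero_tmul, map_zero]
  map_add' a b := by rw [elt, TensorProduct.add_tmul, map_add]; rfl

theorem eltHom_apply (z : Sl2) (a : A) : eltHom z a = elt z a := rfl

theorem elt_smul (z : Sl2) (c : ℂ) (a : A) : elt z (c • a) = c • elt z a := by
  rw [elt, ← TensorProduct.smul_tmul', map_smul]; rfl

section Bracket

attribute [local instance 100] LieRing.ofAssociativeRing

theorem elt_mul_elt (z w : Sl2) (a b : A) :
    elt z a * elt w b = elt w b * elt z a + elt ⁅z, w⁆ (a * b) := by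
  have h : UniversalEnvelopingAlgebra.ι ℂ ⁅a ⊗ₜ[ℂ] z, b ⊗ₜ[ℂ] w⁆ = elt ⁅z, w⁆ (a * b) := by
    rw [LieAlgebra.ExtendScalars.bracket_tmul]
    rfl
  rw [LieHom.map_lie, LieRing.of_associative_ring_bracket] at h
  rw [← h]
  exact (add_sub_cancel _ _).symm

end Bracket

theorem lie_xPlus_xMinus : ⁅xPlus, xMinus⁆ = hElt := by
  refine Subtype.ext ((LieAlgebra.SpecialLinear.sl_bracket _ _ _ _).trans ?_)
  ext i j
  fin_cases i <;> fin_cases j <;> simp [xPlus, xMinus, hElt]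

theorem lie_hElt_xPlus : ⁅hElt, xPlus⁆ = (2 : ℂ) • xPlus := by
  refine Subtype.ext ((LieAlgebra.SpecialLinear.sl_bracket _ _ _ _).trans ?_)
  ext i j
  fin_cases i <;> fin_cases j <;> simp [xPlus, hElt]
  norm_num

theorem lie_hElt_xMinus : ⁅hElt, xMinus⁆ = (-2 : ℂ) • xMinus := by
  refine Subtype.ext ((LieAlgebra.SpecialLinear.sl_bracket _ _ _ _).trans ?_)
  ext i j
  fin_cases i <;> fin_cases j <;> simp [xMinus, hElt]
  norm_num

theorem elt_smul_left (z : Sl2) (c : ℂ) (a : A) : elt (c • z) a = c • elt z a := by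
  rw [elt, TensorProduct.tmul_smul, map_smul]; rfl

theorem elt_hElt_mul_elt_xPlus (a b : A) : elt hElt a * elt xPlus b =
    elt xPlus b * elt hElt a + elt xPlus (2 * (a * b)) := by
  rw [elt_mul_elt, lie_hElt_xPlus, elt_smul_left, ← elt_smul, ofNat_smul_eq_nsmul, nsmul_eq_mul]
  rfl

theorem elt_xMinus_mul_elt_hElt (a b : A) : elt xMinus a * elt hElt b =
    elt hElt b * elt xMinus a + elt xMinus (2 * (a * b)) := by
  rw [elt_mul_elt, ← lie_skew, lie_hElt_xMinus, neg_smul, neg_neg, elt_smul_left, ← elt_smul,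
    ofNat_smul_eq_nsmul, nsmul_eq_mul]
  rfl

theorem elt_xPlus_mul_elt_xMinus (a b : A) : elt xPlus a * elt xMinus b =
    elt xMinus b * elt xPlus a + elt hElt (a * b) := by
  rw [elt_mul_elt, lie_xPlus_xMinus]

/-! ### Multinomial coefficients and divided powers -/

theorem mul_piProd_sub_single {A : Type*} [CommRing A] {φ : A →₀ ℕ} {b : A} (hb : b ∈ φ.support) :
    b * piProd (φ - Finsupp.single b 1) = piProd φ := by
  have h0 : φ b ≠ 0 := Finsupp.mem_support_iff.mp hb
  rw [piProd, piProd, prod_eq_mul_prod_erase _ b _ (pow_zero b),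
    prod_eq_mul_prod_erase φ b _ (pow_zero b), erase_sub_single, ← mul_assoc, ← pow_succ']
  congr 2
  simp only [Finsupp.tsub_apply, Finsupp.single_eq_same]
  omega

theorem multi_sub_single {S : Type*} {φ : S →₀ ℕ} {b : S} (hb : b ∈ φ.support) :
    (φ.degree : ℂ) * multi (φ - Finsupp.single b 1) = φ b * multi φ := by
  have h0 : φ b ≠ 0 := Finsupp.mem_support_iff.mp hb
  obtain ⟨k, hk⟩ := Nat.exists_eq_succ_of_ne_zero h0
  have hd := degree_sub_single_add_one hb
  rw [multi, multi, prod_eq_mul_prod_erase _ b _ (by simp),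
    prod_eq_mul_prod_erase φ b _ (by simp), erase_sub_single, ← hd, Nat.factorial_succ]
  simp only [Finsupp.tsub_apply, Finsupp.single_eq_same, hk, Nat.succ_sub_one, Nat.succ_eq_add_one,
    Nat.factorial_succ]
  have h1 : ((φ.erase b).prod fun _ n => (n.factorial : ℂ)) ≠ 0 :=
    Finset.prod_ne_zero_iff.mpr fun a _ => Nat.cast_ne_zero.mpr (Nat.factorial_ne_zero _)
  have h2 : (k.factorial : ℂ) ≠ 0 := Nat.cast_ne_zero.mpr (Nat.factorial_ne_zero _)
  have h3 : ((k : ℂ) + 1) ≠ 0 := Nat.cast_add_one_ne_zero k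
  push_cast
  field_simp

/-- `m(φ) π(φ)`, the coefficient at `φ` of `1 / (1 - u)` for the generic linear form `u`. -/
def alpha (φ : A →₀ ℕ) : A := multi φ • piProd φ

theorem alpha_zero : alpha (0 : A →₀ ℕ) = 1 := by
  simp [alpha, multi, piProd]

/-- The multinomial form of Pascal's rule; it says that `∑ m(φ) π(φ) s^φ` inverts `1 - u`. -/
theorem sum_mul_alpha {φ : A →₀ ℕ} (h : φ ≠ 0) :
    ∑ r ∈ antidiagonal φ, linPart r.1 * alpha r.2 = alpha φ := by
  rw [sum_antidiagonal_linPart φ (fun b ψ => b * alpha ψ) (fun ψ => zero_mul _)]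
  have h0 : (φ.degree : ℂ) ≠ 0 :=
    Nat.cast_ne_zero.mpr fun h' => h ((Finsupp.degree_eq_zero_iff φ).mp h')
  have h1 : ∀ b ∈ φ.support, b * alpha (φ - Finsupp.single b 1) =
      (((φ.degree : ℂ)⁻¹ * φ b) * multi φ) • piProd φ := by
    intro b hb
    rw [alpha, mul_smul_comm, mul_piProd_sub_single hb, mul_assoc, ← multi_sub_single hb,
      inv_mul_cancel_left₀ h0]
  rw [sum_congr rfl h1, ← sum_smul, ← sum_mul, ← mul_sum, ← Nat.cast_sum, sum_apply_eq_degree,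
    inv_mul_cancel₀ h0, one_mul, alpha]

theorem xProd_eq_mul_xProd_erase (z : Sl2) (φ : A →₀ ℕ) (b : A) :
    xProd z φ = divPow (elt z b) (φ b) * xProd z (φ.erase b) := by
  by_cases h : b ∈ φ.support
  · unfold xProd
    rw [← mul_noncommProd_erase φ.support h (fun a => divPow (elt z a) (φ a)) fun a _ b _ _ =>
      (((elt_commute z a b).pow_pow (φ a) (φ b)).smul_left _).smul_right _]
    congr 1
    refine noncommProd_congr (Finsupp.support_erase).symm (fun a ha => ?_) _
    rw [Finsupp.erase_ne]
    rintro rfl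
    simp at ha
  · have h0 : φ b = 0 := Finsupp.notMem_support_iff.mp h
    rw [h0, Finsupp.erase_of_notMem_support h]
    simp [divPow]

theorem elt_mul_divPow (u : U A) (k : ℕ) : u * divPow u k = (k + 1) • divPow u (k + 1) := by
  have h1 : ((k : ℂ) + 1) ≠ 0 := Nat.cast_add_one_ne_zero k
  rw [divPow, divPow, mul_smul_comm, ← pow_succ', ← Nat.cast_smul_eq_nsmul ℂ, smul_smul]
  congr 1
  rw [Nat.factorial_succ]
  push_cast
  field_simp

theorem elt_mul_xProd_sub_single (z : Sl2) {φ : A →₀ ℕ} {b : A} (hb : b ∈ φ.support) :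
    elt z b * xProd z (φ - Finsupp.single b 1) = φ b • xProd z φ := by
  obtain ⟨k, hk⟩ := Nat.exists_eq_succ_of_ne_zero (Finsupp.mem_support_iff.mp hb)
  rw [xProd_eq_mul_xProd_erase z _ b, xProd_eq_mul_xProd_erase z φ b, erase_sub_single, hk,
    ← mul_assoc]
  simp only [Finsupp.tsub_apply, Finsupp.single_eq_same, hk, Nat.succ_eq_add_one,
    Nat.add_sub_cancel]
  rw [elt_mul_divPow, smul_mul_assoc]

/-- The differential equation `E F = (z ⊗ u) F` of `F = ∑ s^φ z(φ)`, coefficient by coefficient. -/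
theorem degree_smul_xProd (z : Sl2) (φ : A →₀ ℕ) :
    φ.degree • xProd z φ = ∑ r ∈ antidiagonal φ, elt z (linPart r.1) * xProd z r.2 := by
  rw [sum_antidiagonal_linPart φ (fun b ψ => elt z b * xProd z ψ)
    (fun ψ => by rw [← eltHom_apply, map_zero, zero_mul]),
    sum_congr rfl fun b hb => elt_mul_xProd_sub_single z hb, ← sum_smul]
  rfl

theorem xProd_zero (z : Sl2) : xProd z (0 : A →₀ ℕ) = 1 := by
  simp [xProd]

theorem commute_xProd_elt (z : Sl2) (φ : A →₀ ℕ) (a : A) : Commute (xProd z φ) (elt z a) :=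
  (Finset.noncommProd_commute _ _ _ _ fun b _ =>
    ((elt_commute z a b).pow_right _).smul_right _).symm

/-! ### The recursions for `D` and `p` as convolutions -/

/-- The coefficient at `(φ, ψ)` of `1 / (1 - u v)`, for the generic linear forms `u = ∑ s_a a` and
`v = ∑ t_b b`. -/
def beta (φ ψ : A →₀ ℕ) : A := if φ.degree = ψ.degree then alpha φ * alpha ψ else 0

theorem beta_of_degree_ne {φ ψ : A →₀ ℕ} (h : φ.degree ≠ ψ.degree) : beta φ ψ = 0 := if_neg h

theorem DOne_eq (z : Sl2) (φ ψ : A →₀ ℕ) (b : A) : DOne z φ ψ b = elt z (b * beta φ ψ) := by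
  rw [DOne, beta]
  split_ifs
  · rw [← elt_smul, alpha, alpha, smul_mul_smul_comm, mul_smul_comm, mul_assoc]
  · rw [mul_zero, ← eltHom_apply, map_zero]

/-- The recursion of `D` as a convolution over all three arguments, valid for `χ = 0` as well. -/
theorem degree_smul_D (z : Sl2) (φ ψ χ : A →₀ ℕ) :
    χ.degree • D z φ ψ χ = ∑ x ∈ antidiagonal φ, ∑ y ∈ antidiagonal ψ, ∑ r ∈ antidiagonal χ,
      elt z (linPart r.1 * beta x.1 y.1) * D z x.2 y.2 r.2 := by
  have h1 : ∀ φ₁ ψ₁ φ₂ ψ₂ : A →₀ ℕ, ∑ r ∈ antidiagonal χ,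
      elt z (linPart r.1 * beta φ₁ ψ₁) * D z φ₂ ψ₂ r.2 =
      ∑ b ∈ χ.support, DOne z φ₁ ψ₁ b * D z φ₂ ψ₂ (χ - Finsupp.single b 1) := by
    intro φ₁ ψ₁ φ₂ ψ₂
    simp only [DOne_eq]
    refine sum_antidiagonal_linPart χ (fun b ρ => elt z (b * beta φ₁ ψ₁) * D z φ₂ ψ₂ ρ) fun ρ => ?_
    rw [zero_mul, ← eltHom_apply, map_zero, zero_mul]
  simp only [h1]
  by_cases hχ : χ = 0
  · simp [hχ]
  have hd : (χ.degree : ℂ) ≠ 0 :=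
    Nat.cast_ne_zero.mpr fun h' => hχ ((Finsupp.degree_eq_zero_iff χ).mp h')
  rw [D_rec_one z φ ψ hχ, ← Nat.cast_smul_eq_nsmul ℂ, smul_inv_smul₀ hd]
  exact sum_Iic_Iic_eq_sum_antidiagonal φ ψ fun φ₁ φ₂ ψ₁ ψ₂ =>
    ∑ b ∈ χ.support, DOne z φ₁ ψ₁ b * D z φ₂ ψ₂ (χ - Finsupp.single b 1)

theorem D_eq_zero_of_degree_ne (z : Sl2) : ∀ (χ φ ψ : A →₀ ℕ), φ.degree ≠ ψ.degree →
    D z φ ψ χ = 0 := by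
  suffices H : ∀ k (χ φ ψ : A →₀ ℕ), χ.degree = k → φ.degree ≠ ψ.degree → D z φ ψ χ = 0 from
    fun χ φ ψ => H _ χ φ ψ rfl
  intro k
  induction k with
  | zero =>
    intro χ φ ψ hχ h
    rw [(Finsupp.degree_eq_zero_iff χ).mp hχ, D_zero, if_neg (by omega)]
  | succ k ih =>
    intro χ φ ψ hχ h
    have hχ0 : χ ≠ 0 := by
      rintro rfl
      simp at hχ
    rw [D_rec_one z φ ψ hχ0, sum_eq_zero, smul_zero]
    intro φ₁ hφ₁
    refine sum_eq_zero fun ψ₁ hψ₁ => sum_eq_zero fun b hb => ?_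
    by_cases he : φ₁.degree = ψ₁.degree
    · rw [ih _ _ _ (by have := degree_sub_single_add_one hb; omega), mul_zero]
      have h1 : (φ - φ₁).degree + φ₁.degree = φ.degree := by
        rw [← map_add, tsub_add_cancel_of_le (mem_Iic.mp hφ₁)]
      have h2 : (ψ - ψ₁).degree + ψ₁.degree = ψ.degree := by
        rw [← map_add, tsub_add_cancel_of_le (mem_Iic.mp hψ₁)]
      omega
    · rw [DOne, if_neg he, zero_mul]

theorem commute_D_elt (z : Sl2) (a : A) : ∀ χ φ ψ : A →₀ ℕ, Commute (D z φ ψ χ) (elt z a) := by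
  suffices H : ∀ k (χ φ ψ : A →₀ ℕ), χ.degree = k → Commute (D z φ ψ χ) (elt z a) from
    fun χ φ ψ => H _ χ φ ψ rfl
  intro k
  induction k with
  | zero =>
    intro χ φ ψ hχ
    rw [(Finsupp.degree_eq_zero_iff χ).mp hχ, D_zero]
    split_ifs
    · exact Commute.one_left _
    · exact Commute.zero_left _
  | succ k ih =>
    intro χ φ ψ hχ
    have hχ0 : χ ≠ 0 := by
      rintro rfl
      simp at hχ
    rw [D_rec_one z φ ψ hχ0]
    refine Commute.smul_left (Commute.sum_left _ _ _ fun φ₁ _ => Commute.sum_left _ _ _ fun ψ₁ _ =>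
      Commute.sum_left _ _ _ fun b hb => ?_) _
    rw [DOne_eq]
    exact (elt_commute z _ a).mul_left
      (ih _ _ _ (by have := degree_sub_single_add_one hb; omega))

theorem D_zero_zero (z : Sl2) : ∀ χ : A →₀ ℕ, D z 0 0 χ = xProd z χ := by
  suffices H : ∀ k (χ : A →₀ ℕ), χ.degree = k → D z 0 0 χ = xProd z χ from fun χ => H _ χ rfl
  intro k
  induction k with
  | zero =>
    intro χ hχ
    rw [(Finsupp.degree_eq_zero_iff χ).mp hχ, D_zero, xProd_zero]
    simp
  | succ k ih =>
    intro χ hχ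
    have hχ0 : χ.degree ≠ 0 := by omega
    refine nsmul_right_injective hχ0 ?_
    change χ.degree • D z 0 0 χ = χ.degree • xProd z χ
    rw [degree_smul_D, degree_smul_xProd]
    simp only [HasAntidiagonal.antidiagonal_zero, sum_singleton]
    refine sum_congr rfl fun r hr => ?_
    have hb : beta (0 : A →₀ ℕ) 0 = 1 := by simp [beta, alpha_zero]
    rw [hb, mul_one]
    by_cases hd : r.1.degree = 1
    · have hs : r.1.degree + r.2.degree = χ.degree := by
        rw [← map_add, HasAntidiagonal.mem_antidiagonal.mp hr]
      rw [ih r.2 (by omega)]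
    · rw [linPart_of_degree_ne_one hd, ← eltHom_apply, map_zero, zero_mul, zero_mul]

theorem p_zero_left (χ : A →₀ ℕ) : p 0 χ = if χ = 0 then 1 else 0 := by
  split_ifs with h
  · rw [h, p_zero_zero]
  · refine p_eq_zero fun h' => h ?_
    rw [map_zero] at h'
    exact (Finsupp.degree_eq_zero_iff χ).mp h'.symm

/-- The recursion of `p` as a convolution. Terms with `|ψ₁| ≠ |ψ₂|` may be dropped, because their
factor `p(φ - ψ₁, χ - ψ₂)` vanishes when `|φ| = |χ|`, and the whole sum vanishes otherwise. -/
theorem degree_smul_p (φ χ : A →₀ ℕ) :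
    φ.degree • p φ χ = -∑ x ∈ antidiagonal φ, ∑ y ∈ antidiagonal χ,
      elt hElt (if x.1 = 0 then 0 else beta x.1 y.1) * p x.2 y.2 := by
  by_cases hφ : φ = 0
  · subst hφ
    simp [← eltHom_apply]
  have hd : (φ.degree : ℂ) ≠ 0 :=
    Nat.cast_ne_zero.mpr fun h' => hφ ((Finsupp.degree_eq_zero_iff φ).mp h')
  by_cases hdeg : φ.degree = χ.degree
  swap
  · rw [p_eq_zero hdeg, smul_zero, sum_eq_zero, neg_zero]
    intro x hx
    refine sum_eq_zero fun y hy => ?_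
    have h1 : x.1.degree + x.2.degree = φ.degree := by
      rw [← map_add, HasAntidiagonal.mem_antidiagonal.mp hx]
    have h2 : y.1.degree + y.2.degree = χ.degree := by
      rw [← map_add, HasAntidiagonal.mem_antidiagonal.mp hy]
    by_cases h3 : x.2.degree = y.2.degree
    · rw [beta_of_degree_ne (by omega), ite_self, ← eltHom_apply, map_zero, zero_mul]
    · rw [p_eq_zero h3, mul_zero]
  rw [p_rec hφ, if_pos hdeg, ← Nat.cast_smul_eq_nsmul ℂ, smul_smul, mul_neg, mul_one_div_cancel hd,
    neg_smul, one_smul]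
  rw [← sum_Iic_Iic_eq_sum_antidiagonal φ χ fun φ₁ φ₂ χ₁ χ₂ =>
    elt hElt (if φ₁ = 0 then 0 else beta φ₁ χ₁) * p φ₂ χ₂]
  -- The terms with `φ₁ = 0` vanish by definition, those with `χ₁ = 0 ≠ φ₁` by degree.
  rw [← add_sum_erase (Iic φ) _ (mem_Iic.mpr zero_le)]
  rw [sum_eq_zero (s := Iic χ), zero_add]
  swap
  · intro ψ _
    rw [if_pos rfl, ← eltHom_apply, map_zero, zero_mul]
  congr 1
  refine sum_congr rfl fun φ₁ hφ₁ => ?_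
  have h0 : φ₁.degree ≠ 0 := fun h => ne_of_mem_erase hφ₁ ((Finsupp.degree_eq_zero_iff _).mp h)
  rw [← add_sum_erase (Iic χ) _ (mem_Iic.mpr zero_le), if_neg (ne_of_mem_erase hφ₁),
    beta_of_degree_ne (by simpa using h0), ← eltHom_apply, map_zero, zero_mul, zero_add]
  refine sum_congr rfl fun χ₁ hχ₁ => ?_
  by_cases h : φ₁.degree = χ₁.degree
  · rw [if_neg (ne_of_mem_erase hφ₁), beta, if_pos h, alpha, alpha, smul_mul_smul_comm, elt_smul, smul_mul_assoc]
  · have h1 : (φ - φ₁).degree + φ₁.degree = φ.degree := by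
      rw [← map_add, tsub_add_cancel_of_le (mem_Iic.mp (mem_of_mem_erase hφ₁))]
    have h2 : (χ - χ₁).degree + χ₁.degree = χ.degree := by
      rw [← map_add, tsub_add_cancel_of_le (mem_Iic.mp (mem_of_mem_erase hχ₁))]
    rw [p_eq_zero (by omega), mul_zero, mul_zero, smul_zero]

theorem commute_p_elt (a : A) : ∀ φ χ : A →₀ ℕ, Commute (p φ χ) (elt hElt a) := by
  suffices H : ∀ k (φ χ : A →₀ ℕ), φ.degree = k → Commute (p φ χ) (elt hElt a) from
    fun φ χ => H _ φ χ rfl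
  intro k
  induction k using Nat.strong_induction_on with
  | _ k ih =>
    intro φ χ hk
    by_cases hφ : φ = 0
    · rw [hφ, p_zero_left]
      split_ifs
      · exact Commute.one_left _
      · exact Commute.zero_left _
    rw [p_rec hφ]
    refine Commute.smul_left (Commute.sum_left _ _ _ fun φ₁ hφ₁ => Commute.sum_left _ _ _
      fun ψ₁ _ => Commute.smul_left ((elt_commute hElt _ a).mul_left (ih _ ?_ _ _ rfl)) _) _
    rw [← hk]
    exact degree_sub_lt (ne_of_mem_erase hφ₁) (mem_Iic.mp (mem_of_mem_erase hφ₁))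

/-! ### Differential equations in a representation of `𝔰𝔩₂ ⊗ C` -/

section Representation

variable {σ B C : Type*} [Ring B] [CommRing C] {X H Y : C →+ B} (ω : σ → ℕ)

/-- Relations of the form `[x a, y b] = 2 y(ab)` persist for power series. -/
theorem lift_mul_lift_two {x y : C →+ B} (h : ∀ a b, x a * y b = y b * x a + y (2 * (a * b)))
    (f g : MvPowerSeries σ C) :
    lift x f * lift y g = lift y g * lift x f + lift y (2 * (f * g)) := by
  rw [lift_mul_lift (z := y + y) fun a b => ?_, two_mul, map_add]
  · rfl
  · rw [h, two_mul, map_add, AddMonoidHom.add_apply]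

/-- Relations of the form `[x a, y b] = 2 x(ab)` persist for power series. -/
theorem lift_mul_lift_two' {x y : C →+ B} (h : ∀ a b, x a * y b = y b * x a + x (2 * (a * b)))
    (f g : MvPowerSeries σ C) :
    lift x f * lift y g = lift y g * lift x f + lift x (2 * (f * g)) := by
  rw [lift_mul_lift (z := x + x) fun a b => ?_, two_mul, map_add]
  · rfl
  · rw [h, two_mul, map_add, AddMonoidHom.add_apply]

/-- `P` and `Y v` satisfy `P (Y v) = Y w P` up to a solution of `E Z = H c Z`. -/
theorem euler_weight_sub (hYH : ∀ a b, Y a * H b = H b * Y a + Y (2 * (a * b)))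
    {P : MvPowerSeries σ B} {c v w : MvPowerSeries σ C} (hP : euler ω P = lift H c * P)
    (hv : euler ω v = 0) (hw : euler ω w = -(2 * (w * c))) :
    euler ω (P * lift Y v - lift Y w * P) = lift H c * (P * lift Y v - lift Y w * P) := by
  rw [map_sub, euler_mul, euler_mul, hP, euler_lift, euler_lift, hv, hw, map_zero, map_neg,
    ← mul_assoc (lift Y w), lift_mul_lift_two' hYH, mul_sub]
  noncomm_ring

/-- The two sides of `N (Y v) = (Y v + H (v z) - X (v z²)) N` differ by a solution of
`E Z = X (E z) Z`, when `E v = 0`. -/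
theorem euler_conj_sub (hXX : ∀ a b, Commute (X a) (X b))
    (hHX : ∀ a b, H a * X b = X b * H a + X (2 * (a * b)))
    (hXY : ∀ a b, X a * Y b = Y b * X a + H (a * b))
    {N : MvPowerSeries σ B} {v z : MvPowerSeries σ C} (hN : euler ω N = lift X (euler ω z) * N)
    (hv : euler ω v = 0) :
    euler ω (N * lift Y v - (lift Y v + lift H (v * z) - lift X (v * z ^ 2)) * N) =
      lift X (euler ω z) *
        (N * lift Y v - (lift Y v + lift H (v * z) - lift X (v * z ^ 2)) * N) := by
  have hX : euler ω (v * z ^ 2) = 2 * (v * z * euler ω z) := by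
    rw [pow_two, euler_mul, euler_mul ω z, hv]
    ring
  have h1 : lift Y v * lift X (euler ω z) =
      lift X (euler ω z) * lift Y v - lift H (v * euler ω z) := by
    rw [lift_mul_lift hXY, mul_comm (euler ω z) v, add_sub_cancel_right]
  have h2 : lift X (v * z ^ 2) * lift X (euler ω z) = lift X (euler ω z) * lift X (v * z ^ 2) :=
    commute_of_coeff fun _ _ => hXX _ _
  have h3 : (lift Y v + lift H (v * z) - lift X (v * z ^ 2)) * lift X (euler ω z) =
      lift X (euler ω z) * (lift Y v + lift H (v * z) - lift X (v * z ^ 2)) -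
        lift H (v * euler ω z) + lift X (2 * (v * z * euler ω z)) := by
    rw [sub_mul, add_mul, h1, h2, lift_mul_lift_two hHX]
    noncomm_ring
  rw [map_sub, euler_mul, euler_mul, map_sub, map_add, hN, euler_lift, euler_lift, euler_lift, hv,
    hX, euler_mul, hv, zero_mul, zero_add, map_zero, mul_zero, ← mul_assoc _ (lift X (euler ω z)),
    h3]
  noncomm_ring

/-- The product `M P N` solves the equation `E Z = Z (Y v)` that characterizes `exp (Y v)`. -/
theorem euler_gauss {M P N : MvPowerSeries σ B} {v w z : MvPowerSeries σ C}
    (hM : euler ω M = M * lift Y w) (hP : euler ω P = P * lift H (v * z))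
    (hN : euler ω N = lift X (-(v * z ^ 2)) * N) (hPY : P * lift Y v = lift Y w * P)
    (hNY : N * lift Y v = (lift Y v + lift H (v * z) - lift X (v * z ^ 2)) * N) :
    euler ω (M * (P * N)) = M * (P * N) * lift Y v := by
  have h1 : M * lift Y w * (P * N) = M * (P * lift Y v) * N := by
    rw [hPY]
    noncomm_ring
  rw [mul_assoc M, mul_assoc P, hNY, euler_mul, euler_mul, hM, hP, hN, h1, map_neg]
  noncomm_ring

end Representation

/-! ### Generating functions in two sets of variables -/

section TwoSets

variable {S T B : Type*} [Ring B]

/-- The power series with the given coefficients, in variables `s_a` (the left summand) and `t_b`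
(the right summand). -/
def biSeries (f : (S →₀ ℕ) → (T →₀ ℕ) → B) : MvPowerSeries (S ⊕ T) B := fun n =>
  f (n.comapDomain Sum.inl Sum.inl_injective.injOn) (n.comapDomain Sum.inr Sum.inr_injective.injOn)

theorem coeff_biSeries (f : (S →₀ ℕ) → (T →₀ ℕ) → B) (φ : S →₀ ℕ) (χ : T →₀ ℕ) :
    coeff (Finsupp.sumElim φ χ) (biSeries f) = f φ χ := by
  change f _ _ = _
  rw [Finsupp.comapDomain_inl_sumElim, Finsupp.comapDomain_inr_sumElim]

theorem weight_sumElim (ω : S ⊕ T → ℕ) (φ : S →₀ ℕ) (χ : T →₀ ℕ) :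
    Finsupp.weight ω (Finsupp.sumElim φ χ) =
      Finsupp.weight (ω ∘ Sum.inl) φ + Finsupp.weight (ω ∘ Sum.inr) χ := by
  rw [Finsupp.sumElim_eq_add, map_add, weight_mapDomain, weight_mapDomain]

/-- The weight that counts the variables in the left summand. -/
def wtL : S ⊕ T → ℕ := Sum.elim (fun _ => 1) (fun _ => 0)

/-- The weight that counts the variables in the right summand. -/
def wtR : S ⊕ T → ℕ := Sum.elim (fun _ => 0) (fun _ => 1)

theorem weight_wtL (φ : S →₀ ℕ) (χ : T →₀ ℕ) :
    Finsupp.weight wtL (Finsupp.sumElim φ χ) = φ.degree := by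
  rw [weight_sumElim, Finsupp.weight_apply, Finsupp.weight_apply]
  simp [wtL, Finsupp.sum, Finsupp.degree_apply]

theorem weight_wtR (φ : S →₀ ℕ) (χ : T →₀ ℕ) :
    Finsupp.weight wtR (Finsupp.sumElim φ χ) = χ.degree := by
  rw [weight_sumElim, Finsupp.weight_apply, Finsupp.weight_apply]
  simp [wtR, Finsupp.sum, Finsupp.degree_apply]

theorem coeff_sumElim_one (φ : S →₀ ℕ) (χ : T →₀ ℕ) :
    coeff (Finsupp.sumElim φ χ) (1 : MvPowerSeries (S ⊕ T) B) = if φ = 0 ∧ χ = 0 then 1 else 0 := by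
  rw [coeff_one]
  exact if_congr (by rw [← Finsupp.sumElim_zero_zero, sumElim_inj]) rfl rfl

theorem coeff_eq_zero_of_wtL {F : MvPowerSeries (S ⊕ T) B}
    (h : ∀ χ, coeff (Finsupp.sumElim 0 χ) F = 0) (n : S ⊕ T →₀ ℕ)
    (hn : Finsupp.weight wtL n = 0) : coeff n F = 0 := by
  rw [← Finsupp.comapDomain_sumElim_comapDomain n] at hn ⊢
  rw [weight_wtL] at hn
  rw [(Finsupp.degree_eq_zero_iff _).mp hn, h]

theorem coeff_eq_zero_of_wtR {F : MvPowerSeries (S ⊕ T) B}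
    (h : ∀ φ, coeff (Finsupp.sumElim φ 0) F = 0) (n : S ⊕ T →₀ ℕ)
    (hn : Finsupp.weight wtR n = 0) : coeff n F = 0 := by
  rw [← Finsupp.comapDomain_sumElim_comapDomain n] at hn ⊢
  rw [weight_wtR] at hn
  rw [(Finsupp.degree_eq_zero_iff _).mp hn, h]

/-- A series in the variables `s_a` alone. -/
def serL (f : (S →₀ ℕ) → B) : MvPowerSeries (S ⊕ T) B := biSeries fun φ χ => if χ = 0 then f φ else 0

/-- A series in the variables `t_b` alone. -/
def serR (f : (T →₀ ℕ) → B) : MvPowerSeries (S ⊕ T) B := biSeries fun φ χ => if φ = 0 then f χ else 0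

theorem coeff_serL (f : (S →₀ ℕ) → B) (φ : S →₀ ℕ) (χ : T →₀ ℕ) :
    coeff (Finsupp.sumElim φ χ) (serL f) = if χ = 0 then f φ else 0 := coeff_biSeries _ _ _

theorem coeff_serR (f : (T →₀ ℕ) → B) (φ : S →₀ ℕ) (χ : T →₀ ℕ) :
    coeff (Finsupp.sumElim φ χ) (serR f) = if φ = 0 then f χ else 0 := coeff_biSeries _ _ _

theorem sum_antidiagonal_eq_zero_left {N : Type*} [AddCommMonoid N] (χ : S →₀ ℕ)
    (f : (S →₀ ℕ) → (S →₀ ℕ) → N) (h : ∀ a b, a ≠ 0 → f a b = 0) :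
    ∑ x ∈ antidiagonal χ, f x.1 x.2 = f 0 χ := by
  rw [sum_eq_single (0, χ)]
  · rintro ⟨a, b⟩ hab hne
    refine h _ _ ?_
    rintro rfl
    rw [HasAntidiagonal.mem_antidiagonal] at hab
    exact hne (by rw [← hab]; simp)
  · intro hn
    simp at hn

theorem coeff_serL_mul (f : (S →₀ ℕ) → B) (F : MvPowerSeries (S ⊕ T) B) (φ : S →₀ ℕ)
    (χ : T →₀ ℕ) : coeff (Finsupp.sumElim φ χ) (serL f * F) =
      ∑ x ∈ antidiagonal φ, f x.1 * coeff (Finsupp.sumElim x.2 χ) F := by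
  rw [coeff_sumElim_mul]
  refine sum_congr rfl fun x _ => ?_
  simp only [coeff_serL]
  rw [sum_antidiagonal_eq_zero_left χ
    (fun a b => (if a = 0 then f x.1 else 0) * coeff (Finsupp.sumElim x.2 b) F)]
  · rw [if_pos rfl]
  · intro a b ha
    rw [if_neg ha, zero_mul]

theorem coeff_serR_mul (f : (T →₀ ℕ) → B) (F : MvPowerSeries (S ⊕ T) B) (φ : S →₀ ℕ)
    (χ : T →₀ ℕ) : coeff (Finsupp.sumElim φ χ) (serR f * F) =
      ∑ y ∈ antidiagonal χ, f y.1 * coeff (Finsupp.sumElim φ y.2) F := by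
  rw [coeff_sumElim_mul, sum_antidiagonal_eq_zero_left φ (fun a b => ∑ y ∈ antidiagonal χ,
    coeff (Finsupp.sumElim a y.1) (serR f) * coeff (Finsupp.sumElim b y.2) F)]
  · simp only [coeff_serR, if_true]
  · intro a b ha
    simp only [coeff_serR, if_neg ha, zero_mul, sum_const_zero]

/-- A factor that is `1` at `s = 0` does not change a product at `s = 0`. -/
theorem coeff_zero_left_mul {F : MvPowerSeries (S ⊕ T) B}
    (hF : ∀ χ, coeff (Finsupp.sumElim 0 χ) F = if χ = 0 then 1 else 0)
    (G : MvPowerSeries (S ⊕ T) B) (χ : T →₀ ℕ) :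
    coeff (Finsupp.sumElim 0 χ) (F * G) = coeff (Finsupp.sumElim 0 χ) G := by
  rw [coeff_sumElim_mul, HasAntidiagonal.antidiagonal_zero, sum_singleton,
    sum_antidiagonal_eq_zero_left χ fun a b =>
      coeff (Finsupp.sumElim 0 a) F * coeff (Finsupp.sumElim 0 b) G]
  · rw [hF, if_pos rfl, one_mul]
  · intro a b ha
    rw [hF, if_neg ha, zero_mul]

theorem coeff_zero_left_mul' {F : MvPowerSeries (S ⊕ T) B}
    (hF : ∀ χ, coeff (Finsupp.sumElim 0 χ) F = if χ = 0 then 1 else 0)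
    (G : MvPowerSeries (S ⊕ T) B) (χ : T →₀ ℕ) :
    coeff (Finsupp.sumElim 0 χ) (G * F) = coeff (Finsupp.sumElim 0 χ) G := by
  rw [coeff_sumElim_mul, HasAntidiagonal.antidiagonal_zero, sum_singleton,
    sum_antidiagonal_comm χ fun a b =>
      coeff (Finsupp.sumElim 0 a) G * coeff (Finsupp.sumElim 0 b) F,
    sum_antidiagonal_eq_zero_left χ fun a b =>
      coeff (Finsupp.sumElim 0 b) G * coeff (Finsupp.sumElim 0 a) F]
  · rw [hF, if_pos rfl, mul_one]
  · intro a b ha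
    rw [hF, if_neg ha, mul_zero]

/-- A factor that is `1` at `t = 0` does not change a product at `t = 0`. -/
theorem coeff_zero_right_mul {F : MvPowerSeries (S ⊕ T) B}
    (hF : ∀ φ, coeff (Finsupp.sumElim φ 0) F = if φ = 0 then 1 else 0)
    (G : MvPowerSeries (S ⊕ T) B) (φ : S →₀ ℕ) :
    coeff (Finsupp.sumElim φ 0) (F * G) = coeff (Finsupp.sumElim φ 0) G := by
  rw [coeff_sumElim_mul]
  simp only [HasAntidiagonal.antidiagonal_zero, sum_singleton]
  rw [sum_antidiagonal_eq_zero_left φ fun a b =>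
      coeff (Finsupp.sumElim a 0) F * coeff (Finsupp.sumElim b 0) G]
  · rw [hF, if_pos rfl, one_mul]
  · intro a b ha
    rw [hF, if_neg ha, zero_mul]

theorem coeff_zero_right_mul' {F : MvPowerSeries (S ⊕ T) B}
    (hF : ∀ φ, coeff (Finsupp.sumElim φ 0) F = if φ = 0 then 1 else 0)
    (G : MvPowerSeries (S ⊕ T) B) (φ : S →₀ ℕ) :
    coeff (Finsupp.sumElim φ 0) (G * F) = coeff (Finsupp.sumElim φ 0) G := by
  rw [coeff_sumElim_mul]
  simp only [HasAntidiagonal.antidiagonal_zero, sum_singleton]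
  rw [sum_antidiagonal_comm φ fun a b =>
      coeff (Finsupp.sumElim a 0) G * coeff (Finsupp.sumElim b 0) F,
    sum_antidiagonal_eq_zero_left φ fun a b =>
      coeff (Finsupp.sumElim b 0) G * coeff (Finsupp.sumElim a 0) F]
  · rw [hF, if_pos rfl, mul_one]
  · intro a b ha
    rw [hF, if_neg ha, mul_zero]

theorem euler_wtR_serL (f : (S →₀ ℕ) → B) : euler wtR (serL f : MvPowerSeries (S ⊕ T) B) = 0 := by
  refine ext_sumElim fun φ χ => ?_
  rw [coeff_euler, weight_wtR, coeff_serL]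
  split_ifs with h <;> simp [h]

theorem euler_wtL_serR (f : (T →₀ ℕ) → B) : euler wtL (serR f : MvPowerSeries (S ⊕ T) B) = 0 := by
  refine ext_sumElim fun φ χ => ?_
  rw [coeff_euler, weight_wtL, coeff_serR]
  split_ifs with h <;> simp [h]

theorem mapDomain_sumElim_id (g : T → S) (n : S →₀ ℕ) (m : T →₀ ℕ) :
    (Finsupp.sumElim n m).mapDomain (Sum.elim id g) = n + m.mapDomain g := by
  rw [Finsupp.sumElim_eq_add, Finsupp.mapDomain_add, ← Finsupp.mapDomain_comp,
    ← Finsupp.mapDomain_comp, Sum.elim_comp_inl, Sum.elim_comp_inr, Finsupp.mapDomain_id]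

theorem tendstoCofinite_sumElim_id {g : T → S} (hg : Function.Injective g) :
    Filter.TendstoCofinite (Sum.elim id g) := by
  rw [Filter.tendstoCofinite_iff_finite_preimage_singleton]
  intro b
  refine (((Set.finite_singleton b).image Sum.inl).union
    (((Set.finite_singleton b).preimage hg.injOn).image Sum.inr)).subset ?_
  rintro (x | x) hx
  · exact Or.inl ⟨x, hx, rfl⟩
  · exact Or.inr ⟨x, hx, rfl⟩

instance : Filter.TendstoCofinite (Sum.elim id Sum.inl : (S ⊕ T) ⊕ S → S ⊕ T) :=
  tendstoCofinite_sumElim_id Sum.inl_injective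

instance : Filter.TendstoCofinite (Sum.elim id Sum.inr : (S ⊕ T) ⊕ T → S ⊕ T) :=
  tendstoCofinite_sumElim_id Sum.inr_injective

/-- Merging a third set of variables with the first one. -/
theorem coeff_push_inl (F : MvPowerSeries ((S ⊕ T) ⊕ S) B) (φ : S →₀ ℕ) (χ : T →₀ ℕ) :
    coeff (Finsupp.sumElim φ χ) (push (Sum.elim id Sum.inl) F) = ∑ x ∈ antidiagonal φ,
      coeff (Finsupp.sumElim (Finsupp.sumElim x.1 χ) x.2) F := by
  rw [coeff_push]
  symm
  refine sum_nbij (fun x => Finsupp.sumElim (Finsupp.sumElim x.1 χ) x.2) ?_ ?_ ?_ fun _ _ => rfl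
  · rintro ⟨a, b⟩ h
    rw [HasAntidiagonal.mem_antidiagonal] at h
    have h0 : b.mapDomain Sum.inl = Finsupp.sumElim b (0 : T →₀ ℕ) := by
      simp [Finsupp.sumElim_eq_add]
    rw [mem_fiber, mapDomain_sumElim_id, h0, ← Finsupp.sumElim_add, h, add_zero]
  · rintro ⟨a, b⟩ _ ⟨a', b'⟩ _ h
    simp only [sumElim_inj] at h
    rw [h.1.1, h.2]
  · intro n hn
    obtain ⟨m, c, rfl⟩ := exists_sumElim n
    obtain ⟨a, b, rfl⟩ := exists_sumElim m
    have h0 : c.mapDomain Sum.inl = Finsupp.sumElim c (0 : T →₀ ℕ) := by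
      simp [Finsupp.sumElim_eq_add]
    rw [mem_coe, mem_fiber, mapDomain_sumElim_id, h0, ← Finsupp.sumElim_add, sumElim_inj,
      add_zero] at hn
    exact ⟨(a, c), HasAntidiagonal.mem_antidiagonal.mpr hn.1, by simp only [hn.2]⟩

/-- Merging a third set of variables with the second one. -/
theorem coeff_push_inr (F : MvPowerSeries ((S ⊕ T) ⊕ T) B) (φ : S →₀ ℕ) (χ : T →₀ ℕ) :
    coeff (Finsupp.sumElim φ χ) (push (Sum.elim id Sum.inr) F) = ∑ x ∈ antidiagonal χ,
      coeff (Finsupp.sumElim (Finsupp.sumElim φ x.1) x.2) F := by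
  rw [coeff_push]
  symm
  refine sum_nbij (fun x => Finsupp.sumElim (Finsupp.sumElim φ x.1) x.2) ?_ ?_ ?_ fun _ _ => rfl
  · rintro ⟨a, b⟩ h
    rw [HasAntidiagonal.mem_antidiagonal] at h
    have h0 : b.mapDomain Sum.inr = Finsupp.sumElim (0 : S →₀ ℕ) b := by
      simp [Finsupp.sumElim_eq_add]
    rw [mem_fiber, mapDomain_sumElim_id, h0, ← Finsupp.sumElim_add, h, add_zero]
  · rintro ⟨a, b⟩ _ ⟨a', b'⟩ _ h
    simp only [sumElim_inj] at h
    rw [h.1.2, h.2]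
  · intro n hn
    obtain ⟨m, c, rfl⟩ := exists_sumElim n
    obtain ⟨a, b, rfl⟩ := exists_sumElim m
    have h0 : c.mapDomain Sum.inr = Finsupp.sumElim (0 : S →₀ ℕ) c := by
      simp [Finsupp.sumElim_eq_add]
    rw [mem_coe, mem_fiber, mapDomain_sumElim_id, h0, ← Finsupp.sumElim_add, sumElim_inj,
      add_zero] at hn
    exact ⟨(b, c), HasAntidiagonal.mem_antidiagonal.mpr hn.2, by simp only [hn.1]⟩

end TwoSets

/-! ### The generating functions of the theorem -/

section Series

variable {A : Type*} [CommRing A]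

/-- The generic linear form `u = ∑ s_a a`. -/
def serU : MvPowerSeries (A ⊕ A) A := serL linPart

/-- The generic linear form `v = ∑ t_b b`. -/
def serV : MvPowerSeries (A ⊕ A) A := serR linPart

theorem euler_wtL_serU : euler wtL (serU : MvPowerSeries (A ⊕ A) A) = serU := by
  refine ext_sumElim fun φ χ => ?_
  rw [coeff_euler, weight_wtL, serU, coeff_serL]
  split_ifs
  · by_cases hd : φ.degree = 1
    · rw [hd, one_smul]
    · rw [linPart_of_degree_ne_one hd, smul_zero]
  · rw [smul_zero]

theorem euler_wtR_serV : euler wtR (serV : MvPowerSeries (A ⊕ A) A) = serV := by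
  refine ext_sumElim fun φ χ => ?_
  rw [coeff_euler, weight_wtR, serV, coeff_serR]
  split_ifs
  · by_cases hd : χ.degree = 1
    · rw [hd, one_smul]
    · rw [linPart_of_degree_ne_one hd, smul_zero]
  · rw [smul_zero]

theorem euler_wtR_serU : euler wtR (serU : MvPowerSeries (A ⊕ A) A) = 0 := euler_wtR_serL _

theorem euler_wtL_serV : euler wtL (serV : MvPowerSeries (A ⊕ A) A) = 0 := euler_wtL_serR _

variable [Algebra ℂ A]

/-- The series `g = 1 / (1 + u v)`. -/
def serG : MvPowerSeries (A ⊕ A) A := biSeries fun φ χ => (-1 : ℤ) ^ χ.degree • beta φ χ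

theorem coeff_serG (φ χ : A →₀ ℕ) :
    coeff (Finsupp.sumElim φ χ) serG = (-1 : ℤ) ^ χ.degree • beta φ χ := coeff_biSeries _ _ _

theorem beta_zero_zero : beta (0 : A →₀ ℕ) 0 = 1 := by
  simp [beta, alpha_zero]

theorem beta_zero_left (χ : A →₀ ℕ) : beta 0 χ = if χ = 0 then 1 else 0 := by
  split_ifs with h
  · rw [h, beta_zero_zero]
  · refine beta_of_degree_ne fun h' => h ?_
    rw [map_zero] at h'
    exact (Finsupp.degree_eq_zero_iff χ).mp h'.symm

theorem beta_zero_right (φ : A →₀ ℕ) : beta φ 0 = if φ = 0 then 1 else 0 := by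
  split_ifs with h
  · rw [h, beta_zero_zero]
  · refine beta_of_degree_ne fun h' => h ?_
    rw [map_zero] at h'
    exact (Finsupp.degree_eq_zero_iff φ).mp h'

/-- The coefficients of `u v g = 1 - g` away from the axes. The factor `v` takes up one unit of
`t`-degree, hence the sign. -/
theorem sum_linPart_mul_beta {φ χ : A →₀ ℕ} (hφ : φ ≠ 0) (hχ : χ ≠ 0) :
    ∑ x ∈ antidiagonal φ, ∑ y ∈ antidiagonal χ,
      linPart x.1 * (linPart y.1 * ((-1 : ℤ) ^ y.2.degree • beta x.2 y.2)) =
      -((-1 : ℤ) ^ χ.degree • beta φ χ) := by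
  have h : ∀ x ∈ antidiagonal φ, ∀ y ∈ antidiagonal χ,
      linPart x.1 * (linPart y.1 * ((-1 : ℤ) ^ y.2.degree • beta x.2 y.2)) =
      -((-1 : ℤ) ^ χ.degree • if φ.degree = χ.degree then
        (linPart x.1 * alpha x.2) * (linPart y.1 * alpha y.2) else 0) := by
    intro x hx y hy
    have h1 : x.1.degree + x.2.degree = φ.degree := by
      rw [← map_add, HasAntidiagonal.mem_antidiagonal.mp hx]
    have h2 : y.1.degree + y.2.degree = χ.degree := by
      rw [← map_add, HasAntidiagonal.mem_antidiagonal.mp hy]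
    by_cases hx1 : x.1.degree = 1
    swap
    · simp [linPart_of_degree_ne_one hx1]
    by_cases hy1 : y.1.degree = 1
    swap
    · simp [linPart_of_degree_ne_one hy1]
    rw [beta, ← h2, hy1, ← h1, hx1, pow_add]
    simp only [Nat.add_left_cancel_iff, pow_one, neg_mul, one_mul, neg_smul, neg_neg]
    split_ifs
    · rw [mul_smul_comm, mul_smul_comm]
      congr 1
      ring
    · simp
  rw [sum_congr rfl fun x hx => sum_congr rfl (h x hx)]
  simp only [sum_neg_distrib, ← smul_sum]
  congr 2
  rw [beta]
  split_ifs
  · rw [← sum_mul_sum, sum_mul_alpha hφ, sum_mul_alpha hχ]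
  · simp

/-- The identity that characterizes `g`; its derivatives follow from it. -/
theorem one_add_mul_serG : (1 + serU * serV) * serG = (1 : MvPowerSeries (A ⊕ A) A) := by
  refine ext_sumElim fun φ χ => ?_
  rw [add_mul, one_mul, mul_assoc, map_add, coeff_sumElim_one, serU, serV, coeff_serL_mul]
  simp only [coeff_serR_mul, coeff_serG, mul_sum]
  by_cases hφ : φ = 0
  · subst hφ
    by_cases hχ : χ = 0 <;> simp [hχ, beta_zero_left, linPart_zero]
  by_cases hχ : χ = 0
  · subst hχ
    simp [hφ, beta_zero_right, linPart_zero]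
  rw [sum_linPart_mul_beta hφ hχ, if_neg fun h => hφ h.1, add_neg_cancel]

theorem euler_serG (ω : A ⊕ A → ℕ) :
    euler ω serG = -(euler ω (serU * serV) * serG ^ 2 : MvPowerSeries (A ⊕ A) A) := by
  have h := congrArg (euler ω) (one_add_mul_serG (A := A))
  rw [euler_mul, map_add, euler_one, zero_add] at h
  linear_combination serG * h - euler ω serG * one_add_mul_serG (A := A)

theorem euler_wtL_serG :
    euler wtL serG = -(serU * serV * serG ^ 2 : MvPowerSeries (A ⊕ A) A) := by
  rw [euler_serG, euler_mul, euler_wtL_serU, euler_wtL_serV, mul_zero, add_zero]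

theorem euler_wtR_serG :
    euler wtR serG = -(serU * serV * serG ^ 2 : MvPowerSeries (A ⊕ A) A) := by
  rw [euler_serG, euler_mul, euler_wtR_serU, euler_wtR_serV, zero_mul, zero_add]

/-! ### The series of `D` -/

/-- The generating function of `(-1)^|ψ| D(φ, ψ, χ)`, in three sets of variables. -/
def serD (z : Sl2) : MvPowerSeries ((A ⊕ A) ⊕ A) (U A) := biSeries fun n χ =>
  (-1 : ℤ) ^ (n.comapDomain Sum.inr Sum.inr_injective.injOn).degree •
    D z (n.comapDomain Sum.inl Sum.inl_injective.injOn)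
      (n.comapDomain Sum.inr Sum.inr_injective.injOn) χ

theorem coeff_serD (z : Sl2) (φ ψ χ : A →₀ ℕ) :
    coeff (Finsupp.sumElim (Finsupp.sumElim φ ψ) χ) (serD z) =
      (-1 : ℤ) ^ ψ.degree • D z φ ψ χ := by
  rw [serD, coeff_biSeries, Finsupp.comapDomain_inl_sumElim, Finsupp.comapDomain_inr_sumElim]

/-- The series `y g`, for a third generic linear form `y`. -/
def serYG : MvPowerSeries ((A ⊕ A) ⊕ A) A := biSeries fun n χ => linPart χ * coeff n serG

theorem coeff_serYG (φ ψ χ : A →₀ ℕ) :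
    coeff (Finsupp.sumElim (Finsupp.sumElim φ ψ) χ) serYG =
      linPart χ * ((-1 : ℤ) ^ ψ.degree • beta φ ψ) := by
  rw [serYG, coeff_biSeries, coeff_serG]

theorem euler_wtR_serYG : euler wtR (serYG : MvPowerSeries ((A ⊕ A) ⊕ A) A) = serYG := by
  refine ext_sumElim fun n χ => ?_
  rw [coeff_euler, weight_wtR, serYG, coeff_biSeries]
  by_cases hd : χ.degree = 1
  · rw [hd, one_smul]
  · rw [linPart_of_degree_ne_one hd, zero_mul, smul_zero]

theorem euler_wtR_serD (z : Sl2) :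
    euler wtR (serD z) = lift (eltHom z) serYG * (serD z : MvPowerSeries ((A ⊕ A) ⊕ A) (U A)) := by
  refine ext_sumElim fun n χ => ?_
  obtain ⟨φ, ψ, rfl⟩ := exists_sumElim n
  rw [coeff_euler, weight_wtR, coeff_serD, smul_comm, degree_smul_D, coeff_sumElim_mul,
    sum_antidiagonal_sumElim φ ψ fun a b => ∑ r ∈ antidiagonal χ,
      coeff (Finsupp.sumElim a r.1) (lift (eltHom z) serYG) * coeff (Finsupp.sumElim b r.2) (serD z)]
  simp only [smul_sum]
  refine sum_congr rfl fun x _ => sum_congr rfl fun y hy => sum_congr rfl fun r _ => ?_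
  rw [coeff_lift, coeff_serYG, coeff_serD, mul_smul_comm (_ ^ _) (linPart _), map_zsmul,
    smul_mul_smul_comm, ← pow_add, ← map_add, HasAntidiagonal.mem_antidiagonal.mp hy]
  rfl

theorem commute_lift (z : Sl2) {σ : Type*} (f g : MvPowerSeries σ A) :
    Commute (lift (eltHom z) f) (lift (eltHom z) g) :=
  commute_of_coeff fun _ _ => elt_commute z _ _

theorem commute_serD_lift (z : Sl2) (f : MvPowerSeries ((A ⊕ A) ⊕ A) A) :
    Commute (serD z) (lift (eltHom z) f) := by
  refine commute_of_coeff fun m n => ?_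
  obtain ⟨k, χ, rfl⟩ := exists_sumElim m
  obtain ⟨φ, ψ, rfl⟩ := exists_sumElim k
  rw [coeff_serD]
  exact (commute_D_elt z _ _ _ _).smul_left _

/-- The series of `D` is the exponential of `z ⊗ y g`: it satisfies the differential equation of
the exponential for every Euler derivation, not just for the one in the recursion. -/
theorem euler_serD (z : Sl2) (ω : (A ⊕ A) ⊕ A → ℕ) :
    euler ω (serD z) = lift (eltHom z) (euler ω serYG) * serD z := by
  have hY : ∀ n, Finsupp.weight wtR n = 0 → coeff n (lift (eltHom z) (serYG (A := A))) = 0 :=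
    coeff_eq_zero_of_wtR fun φ => by
      rw [coeff_lift, serYG, coeff_biSeries, linPart_zero, zero_mul, map_zero]
  have hY' : ∀ n, Finsupp.weight wtR n = 0 →
      coeff n (lift (eltHom z) (euler ω (serYG (A := A)))) = 0 := fun n hn => by
    rw [← euler_lift, coeff_euler, hY n hn, smul_zero]
  refine sub_eq_zero.mp (eq_zero_of_euler_eq_mul wtR hY ?_ ?_)
  · intro n hn
    rw [map_sub, coeff_mul_eq_zero_of_weight wtR hY' n hn, sub_zero, coeff_euler]
    obtain ⟨k, χ, rfl⟩ := exists_sumElim n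
    obtain ⟨φ, ψ, rfl⟩ := exists_sumElim k
    rw [weight_wtR] at hn
    rw [(Finsupp.degree_eq_zero_iff _).mp hn, coeff_serD, D_zero]
    split_ifs with h
    · have h1 : φ = 0 := (Finsupp.degree_eq_zero_iff _).mp (by omega)
      have h2 : ψ = 0 := (Finsupp.degree_eq_zero_iff _).mp (by omega)
      rw [h1, h2, Finsupp.sumElim_zero_zero, Finsupp.sumElim_zero_zero, map_zero, zero_smul]
    · rw [smul_zero, smul_zero]
  -- The equation for `wtR` is the recursion; `serYG` is linear in `y`, so it and its derivative are
  -- both fixed by `euler wtR`.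
  · rw [map_sub, euler_comm, euler_wtR_serD, euler_mul, euler_mul, euler_wtR_serD, euler_lift,
      euler_lift, euler_comm, euler_wtR_serYG, ← mul_assoc (lift (eltHom z) (euler ω serYG)),
      (commute_lift z (euler ω serYG) serYG).eq]
    noncomm_ring

/-- The generating function of `D⁻`, with the third set of variables equal to the second one. It is
`exp (x⁻ ⊗ v g)`. -/
def serM : MvPowerSeries (A ⊕ A) (U A) := push (Sum.elim id Sum.inr) (serD xMinus)

/-- The generating function of `D⁺`, with the third set of variables equal to the first one. It is
`exp (x⁺ ⊗ u g)`. -/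
def serN : MvPowerSeries (A ⊕ A) (U A) := push (Sum.elim id Sum.inl) (serD xPlus)

theorem coeff_serM (φ χ : A →₀ ℕ) : coeff (Finsupp.sumElim φ χ) serM =
    ∑ y ∈ antidiagonal χ, (-1 : ℤ) ^ y.1.degree • DMinus φ y.1 y.2 := by
  rw [serM, coeff_push_inr]
  simp only [coeff_serD]

theorem coeff_serN (φ χ : A →₀ ℕ) : coeff (Finsupp.sumElim φ χ) serN =
    ∑ x ∈ antidiagonal φ, (-1 : ℤ) ^ χ.degree • DPlus x.1 χ x.2 := by
  rw [serN, coeff_push_inl]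
  simp only [coeff_serD]

theorem push_inr_serYG :
    push (Sum.elim id Sum.inr) serYG = (serV * serG : MvPowerSeries (A ⊕ A) A) := by
  refine ext_sumElim fun φ χ => ?_
  rw [coeff_push_inr, serV, coeff_serR_mul, sum_antidiagonal_comm χ fun a b =>
    linPart a * coeff (Finsupp.sumElim φ b) serG]
  simp only [coeff_serYG, coeff_serG]

theorem push_inl_serYG :
    push (Sum.elim id Sum.inl) serYG = (serU * serG : MvPowerSeries (A ⊕ A) A) := by
  refine ext_sumElim fun φ χ => ?_
  rw [coeff_push_inl, serU, coeff_serL_mul, sum_antidiagonal_comm φ fun a b =>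
    linPart a * coeff (Finsupp.sumElim b χ) serG]
  simp only [coeff_serYG, coeff_serG]

theorem euler_serM (ω : A ⊕ A → ℕ) :
    euler ω serM = serM * lift (eltHom xMinus) (euler ω (serV * serG)) := by
  rw [serM, euler_push, euler_serD, ← (commute_serD_lift _ _).eq, push_mul, push_lift,
    ← euler_push, push_inr_serYG]

theorem euler_serN (ω : A ⊕ A → ℕ) :
    euler ω serN = lift (eltHom xPlus) (euler ω (serU * serG)) * serN := by
  rw [serN, euler_push, euler_serD, push_mul, push_lift, ← euler_push, push_inl_serYG]

/-! ### The series of `p` -/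

/-- The generating function of `(-1)^|χ| p(φ, χ)`. It is `exp (h ⊗ log (1 + u v))`. -/
def serP : MvPowerSeries (A ⊕ A) (U A) := biSeries fun φ χ => (-1 : ℤ) ^ χ.degree • p φ χ

theorem coeff_serP (φ χ : A →₀ ℕ) :
    coeff (Finsupp.sumElim φ χ) serP = (-1 : ℤ) ^ χ.degree • p φ χ := coeff_biSeries _ _ _

theorem coeff_serU_mul_serV_mul_serG (φ χ : A →₀ ℕ) :
    coeff (Finsupp.sumElim φ χ) (serU * serV * serG) =
      -((-1 : ℤ) ^ χ.degree • if φ = 0 then 0 else beta φ χ) := by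
  have h : serU * serV * serG = 1 - (serG : MvPowerSeries (A ⊕ A) A) := by
    linear_combination one_add_mul_serG (A := A)
  rw [h, map_sub, coeff_sumElim_one, coeff_serG]
  by_cases hφ : φ = 0
  · subst hφ
    by_cases hχ : χ = 0 <;> simp [hχ, beta_zero_left]
  · simp [hφ]

theorem euler_wtL_serP :
    euler wtL serP = lift (eltHom hElt) (serU * serV * serG) *
      (serP : MvPowerSeries (A ⊕ A) (U A)) := by
  refine ext_sumElim fun φ χ => ?_
  rw [coeff_euler, weight_wtL, coeff_serP, smul_comm, degree_smul_p, coeff_sumElim_mul, smul_neg]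
  simp only [smul_sum, ← sum_neg_distrib]
  refine sum_congr rfl fun x _ => sum_congr rfl fun y hy => ?_
  rw [coeff_lift, coeff_serU_mul_serV_mul_serG, coeff_serP, map_neg, map_zsmul, neg_mul,
    smul_mul_smul_comm, ← pow_add, ← map_add, HasAntidiagonal.mem_antidiagonal.mp hy]
  rfl

/-- Since `p(φ, χ) = 0` unless `|φ| = |χ|`, the two Euler derivations agree on this series. -/
theorem euler_wtR_serP : euler wtR serP = euler wtL (serP : MvPowerSeries (A ⊕ A) (U A)) := by
  refine ext_sumElim fun φ χ => ?_
  rw [coeff_euler, coeff_euler, weight_wtL, weight_wtR, coeff_serP]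
  by_cases h : φ.degree = χ.degree
  · rw [h]
  · rw [p_eq_zero h, smul_zero, smul_zero, smul_zero]

theorem commute_serP_lift (f : MvPowerSeries (A ⊕ A) A) :
    Commute serP (lift (eltHom hElt) f) := by
  refine commute_of_coeff fun m n => ?_
  obtain ⟨φ, ψ, rfl⟩ := exists_sumElim m
  rw [coeff_serP]
  exact (commute_p_elt _ _ _).smul_left _

end Series

/-! ### The factorization -/

section Factorization

variable {A : Type*} [CommRing A] [Algebra ℂ A]

theorem coeff_lift_eq_zero_of_wtL (z : Sl2) {f : MvPowerSeries (A ⊕ A) A} (n : A ⊕ A →₀ ℕ)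
    (hn : Finsupp.weight wtL n = 0) : coeff n (lift (eltHom z) (serU * f)) = 0 := by
  rw [coeff_lift, coeff_mul_eq_zero_of_weight wtL _ n hn, map_zero]
  refine coeff_eq_zero_of_wtL fun χ => ?_
  rw [serU, coeff_serL, linPart_zero, ite_self]

theorem coeff_serP_zero_left (χ : A →₀ ℕ) :
    coeff (Finsupp.sumElim 0 χ) serP = if χ = 0 then (1 : U A) else 0 := by
  rw [coeff_serP, p_zero_left]
  split_ifs with h <;> simp [h]

theorem coeff_serN_zero_left (χ : A →₀ ℕ) :
    coeff (Finsupp.sumElim 0 χ) serN = if χ = 0 then (1 : U A) else 0 := by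
  rw [coeff_serN, HasAntidiagonal.antidiagonal_zero, sum_singleton, DPlus, D_zero]
  simp only [map_zero, zero_add, Finsupp.degree_eq_zero_iff]
  split_ifs with h <;> simp [h]

/-- The series `exp (h ⊗ log (1 + u v))` carries `x⁻ ⊗ v` to `x⁻ ⊗ v g²`: the root of `x⁻` is the
character `-2` of the torus. -/
theorem serP_mul_lift_serV :
    serP * lift (eltHom xMinus) serV =
      lift (eltHom xMinus) (serV * serG ^ 2) * (serP : MvPowerSeries (A ⊕ A) (U A)) := by
  have hw : euler wtL (serV * serG ^ 2 : MvPowerSeries (A ⊕ A) A) =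
      -(2 * (serV * serG ^ 2 * (serU * serV * serG))) := by
    rw [pow_two, euler_mul, euler_mul, euler_wtL_serV, euler_wtL_serG]
    ring
  have hode := euler_weight_sub wtL (Y := eltHom xMinus) (H := eltHom hElt)
    elt_xMinus_mul_elt_hElt euler_wtL_serP euler_wtL_serV hw
  refine sub_eq_zero.mp (eq_zero_of_euler_eq_mul wtL ?_ ?_ hode)
  · rw [mul_assoc]
    exact coeff_lift_eq_zero_of_wtL _
  · refine coeff_eq_zero_of_wtL fun χ => ?_
    have hg : ∀ χ, coeff (Finsupp.sumElim 0 χ) (serG (A := A)) = if χ = 0 then 1 else 0 := by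
      intro χ
      rw [coeff_serG, beta_zero_left]
      split_ifs with h <;> simp [h]
    rw [map_sub, coeff_zero_left_mul coeff_serP_zero_left,
      coeff_zero_left_mul' coeff_serP_zero_left, coeff_lift, coeff_lift, pow_two, ← mul_assoc,
      coeff_zero_left_mul' hg, coeff_zero_left_mul' hg, sub_self]

/-- Conjugation of `x⁻ ⊗ v` by `exp (x⁺ ⊗ u g)`. -/
theorem serN_mul_lift_serV :
    serN * lift (eltHom xMinus) serV =
      (lift (eltHom xMinus) serV + lift (eltHom hElt) (serV * (serU * serG)) -
        lift (eltHom xPlus) (serV * (serU * serG) ^ 2)) *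
      (serN : MvPowerSeries (A ⊕ A) (U A)) := by
  have hode := euler_conj_sub wtL (X := eltHom xPlus) (Y := eltHom xMinus) (H := eltHom hElt)
    (elt_commute xPlus) elt_hElt_mul_elt_xPlus elt_xPlus_mul_elt_xMinus
    (euler_serN (A := A) wtL) euler_wtL_serV
  refine sub_eq_zero.mp (eq_zero_of_euler_eq_mul wtL (fun n hn => ?_) ?_ hode)
  · rw [← euler_lift, coeff_euler, hn, zero_smul]
  · refine coeff_eq_zero_of_wtL fun χ => ?_
    have h0 : Finsupp.weight wtL (Finsupp.sumElim (0 : A →₀ ℕ) χ) = 0 := by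
      rw [weight_wtL, map_zero]
    rw [map_sub, coeff_zero_left_mul coeff_serN_zero_left,
      coeff_zero_left_mul' coeff_serN_zero_left, map_sub, map_add,
      show serV * (serU * serG) = serU * (serV * serG : MvPowerSeries (A ⊕ A) A) by ring,
      show serV * (serU * serG) ^ 2 = serU * (serV * serU * serG ^ 2 : MvPowerSeries (A ⊕ A) A) by
        ring,
      coeff_lift_eq_zero_of_wtL _ _ h0, coeff_lift_eq_zero_of_wtL _ _ h0, add_zero, sub_zero,
      sub_self]

/-- The generating function of `x⁺(φ)`, that is `exp (x⁺ ⊗ u)`. -/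
def serXPlus : MvPowerSeries (A ⊕ A) (U A) := serL (xProd xPlus)

/-- The generating function of `x⁻(χ)`, that is `exp (x⁻ ⊗ v)`. -/
def serXMinus : MvPowerSeries (A ⊕ A) (U A) := serR (xProd xMinus)

theorem euler_wtR_serXMinus :
    euler wtR serXMinus = serXMinus * (lift (eltHom xMinus) serV : MvPowerSeries (A ⊕ A) (U A)) := by
  have hc : Commute serXMinus (lift (eltHom xMinus) serV : MvPowerSeries (A ⊕ A) (U A)) := by
    refine commute_of_coeff fun m n => ?_
    obtain ⟨φ, ψ, rfl⟩ := exists_sumElim m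
    rw [serXMinus, coeff_serR]
    split_ifs
    · exact commute_xProd_elt _ _ _
    · exact Commute.zero_left _
  have hV : lift (eltHom xMinus) serV =
      (serR fun χ => elt xMinus (linPart χ) : MvPowerSeries (A ⊕ A) (U A)) := by
    refine ext_sumElim fun φ χ => ?_
    rw [coeff_lift, serV, coeff_serR, coeff_serR, apply_ite (eltHom xMinus), map_zero]
    rfl
  rw [hc.eq, hV]
  refine ext_sumElim fun φ χ => ?_
  rw [coeff_serR_mul, coeff_euler, weight_wtR, serXMinus]
  simp only [coeff_serR]
  split_ifs
  · exact degree_smul_xProd _ _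
  · simp

theorem coeff_serM_zero_right (φ : A →₀ ℕ) :
    coeff (Finsupp.sumElim φ 0) serM = if φ = 0 then (1 : U A) else 0 := by
  rw [coeff_serM, HasAntidiagonal.antidiagonal_zero, sum_singleton, DMinus, D_zero]
  simp only [map_zero, add_zero, Finsupp.degree_eq_zero_iff, pow_zero, one_smul]

theorem coeff_serP_zero_right (φ : A →₀ ℕ) :
    coeff (Finsupp.sumElim φ 0) serP = if φ = 0 then (1 : U A) else 0 := by
  rw [coeff_serP, map_zero, pow_zero, one_smul]
  split_ifs with h
  · rw [h, p_zero_zero]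
  · refine p_eq_zero fun h' => h ?_
    rw [map_zero] at h'
    exact (Finsupp.degree_eq_zero_iff φ).mp h'

theorem coeff_serN_zero_right (φ : A →₀ ℕ) :
    coeff (Finsupp.sumElim φ 0) serN = xProd xPlus φ := by
  rw [coeff_serN]
  simp only [map_zero, pow_zero, one_smul]
  rw [sum_antidiagonal_eq_zero_left φ fun a b => DPlus a 0 b]
  · exact D_zero_zero _ _
  · intro a b ha
    refine D_eq_zero_of_degree_ne _ _ _ _ fun h => ha ?_
    rw [map_zero] at h
    exact (Finsupp.degree_eq_zero_iff a).mp h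

/-- A Gauss decomposition in the loop group of `SL₂`:
`exp (x⁺ ⊗ u) exp (x⁻ ⊗ v) = exp (x⁻ ⊗ v g) exp (h ⊗ log (1 + u v)) exp (x⁺ ⊗ u g)`. -/
theorem serXPlus_mul_serXMinus :
    serXPlus * serXMinus = (serM * (serP * serN) : MvPowerSeries (A ⊕ A) (U A)) := by
  have hM : euler wtR serM = serM *
      lift (eltHom xMinus) (serV * serG ^ 2 : MvPowerSeries (A ⊕ A) A) := by
    rw [euler_serM, euler_mul, euler_wtR_serV, euler_wtR_serG]
    congr 2
    linear_combination -serV * serG * one_add_mul_serG (A := A)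
  have hP : euler wtR serP = serP *
      lift (eltHom hElt) (serV * (serU * serG) : MvPowerSeries (A ⊕ A) A) := by
    rw [euler_wtR_serP, euler_wtL_serP, (commute_serP_lift _).eq]
    congr 2
    ring
  have hN : euler wtR serN =
      lift (eltHom xPlus) (-(serV * (serU * serG) ^ 2) : MvPowerSeries (A ⊕ A) A) * serN := by
    rw [euler_serN, euler_mul, euler_wtR_serU, euler_wtR_serG]
    congr 2
    ring
  have hR := euler_gauss wtR hM hP hN
    serP_mul_lift_serV serN_mul_lift_serV
  have hode : euler wtR (serXPlus * serXMinus - serM * (serP * serN)) =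
      (serXPlus * serXMinus - serM * (serP * serN)) *
        (lift (eltHom xMinus) serV : MvPowerSeries (A ⊕ A) (U A)) := by
    rw [map_sub, hR, euler_mul, serXPlus, euler_wtR_serL, zero_mul, zero_add,
      euler_wtR_serXMinus, sub_mul, mul_assoc (serL _)]
  refine sub_eq_zero.mp (eq_zero_of_euler_eq_mul_right wtR ?_ ?_ hode)
  · refine coeff_eq_zero_of_wtR fun φ => ?_
    rw [coeff_lift, serV, coeff_serR, linPart_zero, ite_self, map_zero]
  · refine coeff_eq_zero_of_wtR fun φ => ?_
    have hT : ∀ φ : A →₀ ℕ, coeff (Finsupp.sumElim φ 0) serXMinus =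
        if φ = 0 then (1 : U A) else 0 := by
      intro φ
      rw [serXMinus, coeff_serR, xProd_zero]
    rw [map_sub, coeff_zero_right_mul' hT, coeff_zero_right_mul coeff_serM_zero_right,
      coeff_zero_right_mul coeff_serP_zero_right, coeff_serN_zero_right, serXPlus, coeff_serL,
      if_pos rfl, sub_self]

/-! ### Comparison of coefficients -/

/-- The coefficients of the last two factors are the elements `𝔻`, up to sign. -/
theorem coeff_serP_mul_serN (φ χ : A →₀ ℕ) : coeff (Finsupp.sumElim φ χ) (serP * serN) =
    ∑ x ∈ antidiagonal φ, (-1 : ℤ) ^ χ.degree • DD x.1 χ x.2 := by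
  have h : ∀ x ∈ antidiagonal φ, ∀ y ∈ antidiagonal χ, coeff (Finsupp.sumElim x.1 y.1) serP *
      coeff (Finsupp.sumElim x.2 y.2) serN = ∑ w ∈ antidiagonal x.2,
        (-1 : ℤ) ^ χ.degree • (p x.1 y.1 * DPlus w.1 y.2 w.2) := by
    intro x _ y hy
    rw [coeff_serP, coeff_serN, mul_sum]
    refine sum_congr rfl fun w _ => ?_
    rw [smul_mul_smul_comm, ← pow_add, ← map_add, HasAntidiagonal.mem_antidiagonal.mp hy]
  rw [coeff_sumElim_mul, sum_congr rfl fun x hx => sum_congr rfl (h x hx)]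
  have h' : ∀ x : (A →₀ ℕ) × (A →₀ ℕ), ∑ y ∈ antidiagonal χ, ∑ w ∈ antidiagonal x.2,
      (-1 : ℤ) ^ χ.degree • (p x.1 y.1 * DPlus w.1 y.2 w.2) =
      ∑ w ∈ antidiagonal x.2, ∑ y ∈ antidiagonal χ,
        (-1 : ℤ) ^ χ.degree • (p x.1 y.1 * DPlus w.1 y.2 w.2) := fun x => sum_comm
  simp only [h']
  rw [sum_antidiagonal_assoc φ fun a b c => ∑ y ∈ antidiagonal χ,
    (-1 : ℤ) ^ χ.degree • (p a y.1 * DPlus b y.2 c)]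
  refine sum_congr rfl fun x _ => ?_
  rw [DD, sum_Iic_Iic_eq_sum_antidiagonal x.1 χ fun φ₁ φ₂ ψ₁ ψ₂ => p φ₁ ψ₁ * DPlus φ₂ ψ₂ x.2]
  simp only [smul_sum]

end Factorization

end MapAlgebra

end

open MapAlgebra
open Classical in
theorem mainTheorem3 {A : Type*} [CommRing A] [Algebra ℂ A] (φ χ : A →₀ ℕ) :
    xProd xPlus φ * xProd xMinus χ =
      ∑ ψ ∈ Finset.Iic χ ×ˢ Finset.Iic χ with ψ.1 + ψ.2 ≤ χ,
        ∑ ϕ ∈ Finset.Iic φ ×ˢ Finset.Iic φ with ϕ.1 + ϕ.2 ≤ φ,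
          (-1 : U A) ^ (ψ.1.degree + ψ.2.degree) *
            (DMinus ϕ.1 ψ.1 (χ - ψ.1 - ψ.2) * DD ϕ.2 ψ.2 (φ - ϕ.1 - ϕ.2)) := by
  have h := congrArg (MvPowerSeries.coeff (Finsupp.sumElim φ χ)) (serXPlus_mul_serXMinus (A := A))
  have hL : MvPowerSeries.coeff (Finsupp.sumElim φ χ) (serXPlus * serXMinus) =
      xProd xPlus φ * xProd xMinus χ := by
    rw [serXPlus, coeff_serL_mul, sum_antidiagonal_comm φ fun a b =>
      xProd xPlus a * MvPowerSeries.coeff (Finsupp.sumElim b χ) serXMinus,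
      sum_antidiagonal_eq_zero_left φ fun a b =>
        xProd xPlus b * MvPowerSeries.coeff (Finsupp.sumElim a χ) serXMinus]
    · rw [serXMinus, coeff_serR, if_pos rfl]
    · intro a b ha
      rw [serXMinus, coeff_serR, if_neg ha, mul_zero]
  have hS : ∀ ψ : (A →₀ ℕ) × (A →₀ ℕ),
      ∑ ϕ ∈ Finset.Iic φ ×ˢ Finset.Iic φ with ϕ.1 + ϕ.2 ≤ φ,
        (-1 : U A) ^ (ψ.1.degree + ψ.2.degree) *
          (DMinus ϕ.1 ψ.1 (χ - ψ.1 - ψ.2) * DD ϕ.2 ψ.2 (φ - ϕ.1 - ϕ.2)) =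
      ∑ x ∈ Finset.HasAntidiagonal.antidiagonal φ, ∑ w ∈ Finset.HasAntidiagonal.antidiagonal x.2,
        (-1 : U A) ^ (ψ.1.degree + ψ.2.degree) *
          (DMinus x.1 ψ.1 (χ - ψ.1 - ψ.2) * DD w.1 ψ.2 w.2) := fun ψ =>
    sum_filter_add_le_left φ fun a b c => (-1 : U A) ^ (ψ.1.degree + ψ.2.degree) *
      (DMinus a ψ.1 (χ - ψ.1 - ψ.2) * DD b ψ.2 c)
  rw [← hL, h, Finset.sum_congr rfl fun ψ _ => hS ψ]
  rw [sum_filter_add_le_left χ fun a b c => ∑ x ∈ Finset.HasAntidiagonal.antidiagonal φ,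
    ∑ w ∈ Finset.HasAntidiagonal.antidiagonal x.2,
      (-1 : U A) ^ (a.degree + b.degree) * (DMinus x.1 a c * DD w.1 b w.2)]
  -- Both sides now run over decompositions `χ = ψ₁ + ψ₂ + ψ₃`, grouped differently.
  have hT : ∑ y ∈ Finset.HasAntidiagonal.antidiagonal χ, ∑ r ∈ Finset.HasAntidiagonal.antidiagonal y.2,
      (∑ x ∈ Finset.HasAntidiagonal.antidiagonal φ, ∑ w ∈ Finset.HasAntidiagonal.antidiagonal x.2,
        (-1 : U A) ^ (y.1.degree + r.1.degree) * (DMinus x.1 y.1 r.2 * DD w.1 r.1 w.2)) =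
      ∑ y ∈ Finset.HasAntidiagonal.antidiagonal χ, ∑ r ∈ Finset.HasAntidiagonal.antidiagonal y.1,
      (∑ x ∈ Finset.HasAntidiagonal.antidiagonal φ, ∑ w ∈ Finset.HasAntidiagonal.antidiagonal x.2,
        (-1 : U A) ^ (r.1.degree + y.2.degree) * (DMinus x.1 r.1 r.2 * DD w.1 y.2 w.2)) := by
    rw [← sum_antidiagonal_assoc χ fun a b c => ∑ x ∈ Finset.HasAntidiagonal.antidiagonal φ,
      ∑ w ∈ Finset.HasAntidiagonal.antidiagonal x.2,
        (-1 : U A) ^ (a.degree + c.degree) * (DMinus x.1 a b * DD w.1 c w.2)]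
    exact Finset.sum_congr rfl fun y _ => sum_antidiagonal_comm y.2 fun b c =>
      ∑ x ∈ Finset.HasAntidiagonal.antidiagonal φ, ∑ w ∈ Finset.HasAntidiagonal.antidiagonal x.2,
        (-1 : U A) ^ (y.1.degree + b.degree) * (DMinus x.1 y.1 c * DD w.1 b w.2)
  rw [hT, coeff_sumElim_mul, Finset.sum_comm]
  refine Finset.sum_congr rfl fun y _ => ?_
  rw [Finset.sum_comm]
  refine Finset.sum_congr rfl fun x _ => ?_
  rw [coeff_serM, coeff_serP_mul_serN, Finset.sum_mul]
  refine Finset.sum_congr rfl fun r _ => ?_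
  rw [Finset.mul_sum]
  refine Finset.sum_congr rfl fun w _ => ?_
  rw [smul_mul_smul_comm, ← pow_add, zsmul_eq_mul]
  push_cast
  rfl
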